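/- Let $k$ be a field, $Q$ a finite quiver, and $\Gamma = kQ/I$ a bound quiver algebra; that is, $I$ is an ideal of the path algebra $kQ$ such that every path occurring in an element of $I$ has length at least two, and for some $N>1$ all paths of length $N$ lie in $I$. Paths are composed from left to right: $pq$ means first $p$, then $q$. Write $e_a$ for the idempotent of a vertex $a$. Let $i \neq j$ be vertices and let $V$ be a left $\Gamma$-submodule of $\Gamma e_i$ with $e_j\Gamma e_i \subseteq V \subseteq \operatorname{rad} \Gamma e_i$. Let $\Gamma^V_{i\to j} = kQ'/I'$ be the trivial one-arrow extension: $Q'$ is obtained from $Q$ by adding one new arrow $\alpha\colon i\to j$, and $I'$ is the ideal of $kQ'$ generated by $I$ and all elements $z\alpha$ with $z\in kQ e_i$ and $z+I\in V$. Let $M = (\Gamma e_i/V)\otimes_k e_j\Gamma$, a $\Gamma$-bimodule with the left action of $\Gamma$ on the first factor and the right action on the second. Then $M$ is non-zero and finite dimensional over $k$, its right projective dimension is strongly-finite, and $\Gamma^V_{i\to j}$ is isomorphic as a $k$-algebra to the trivial extension $\Gamma\ltimes M$. Here the right projective dimension of $M$ is called strongly-finite if $\operatorname{pd} M_\Gamma<\infty$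 and there is no vertex $a$ such that both $e_aM\neq 0$ and $e_a\Gamma$ is isomorphic to a direct summand of some term of the minimal projective resolution of the right module $M_\Gamma$. Moreover, $$\operatorname{fpd}\Gamma^V_{i\to j}<\infty \iff \operatorname{fpd}\Gamma<\infty,\qquad \operatorname{Fpd}\Gamma^V_{i\to j}<\infty \iff \operatorname{Fpd}\Gamma<\infty,\qquad \operatorname{gd}\Gamma^V_{i\to j}<\infty \iff \operatorname{gd}\Gamma<\infty ,$$ where $\operatorname{fpd}$ (respectively $\operatorname{Fpd}$) is the supremum of the projective dimensions of the finitely generated (respectively all) left modules of finite projective dimension, and $\operatorname{gd}$ is the supremum of the projective dimensions of all left modules. -/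

import Mathlib

open scoped TensorProduct

universe u v w m

/-! ## The path algebra of a quiver -/

/-- The set of all paths of a quiver, trivial paths included. -/
abbrev AllPaths (Q : Type u) [Quiver.{v} Q] : Type (max u v) :=
  Σ a b : Q, Quiver.Path a b

/-- The path algebra `kQ`: the vector space with basis all paths of `Q`. -/
def PathAlgebra (k : Type w) (Q : Type u) [CommRing k] [Quiver.{v} Q] : Type (max u v w) :=
  AllPaths Q →₀ k

namespace PathAlgebra

section

variable {k : Type w} {Q : Type u} [CommRing k] [Quiver.{v} Q]

noncomputable instance : AddCommGroup (PathAlgebra k Q) :=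
  inferInstanceAs (AddCommGroup (AllPaths Q →₀ k))

noncomputable instance : Module k (PathAlgebra k Q) :=
  inferInstanceAs (Module k (AllPaths Q →₀ k))

/-- The coefficient of a path in an element of the path algebra. -/
def coeff (x : PathAlgebra k Q) (p : AllPaths Q) : k :=
  (show AllPaths Q →₀ k from x) p

variable (k) in
/-- A path, seen as an element of the path algebra. -/
noncomputable def path {a b : Q} (p : Quiver.Path a b) : PathAlgebra k Q :=
  (Finsupp.single (⟨a, b, p⟩ : AllPaths Q) (1 : k) : AllPaths Q →₀ k)

variable (k) in
/-- The trivial path at a vertex. -/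
noncomputable def triv (a : Q) : PathAlgebra k Q :=
  path k (Quiver.Path.nil : Quiver.Path a a)

variable (k) in
/-- Linear extension of a function defined on paths. -/
noncomputable def lift {N : Type*} [AddCommGroup N] [Module k N] (f : AllPaths Q → N) :
    PathAlgebra k Q →ₗ[k] N :=
  Finsupp.linearCombination k f

@[simp] lemma lift_path {N : Type*} [AddCommGroup N] [Module k N] (f : AllPaths Q → N)
    {a b : Q} (p : Quiver.Path a b) : lift k f (path k p) = f ⟨a, b, p⟩ :=
  (Finsupp.linearCombination_single k (1 : k) (⟨a, b, p⟩ : AllPaths Q)).trans (one_smul k _)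

lemma lin_ext {N : Type*} [AddCommGroup N] [Module k N] {f g : PathAlgebra k Q →ₗ[k] N}
    (h : ∀ (a b : Q) (p : Quiver.Path a b), f (path k p) = g (path k p)) : f = g :=
  Finsupp.lhom_ext' (R := k) (M := k) (α := AllPaths Q) fun ⟨a, b, p⟩ =>
    LinearMap.ext_ring (h a b p)

open Classical in
variable (k) in
/-- The product of two paths: first `p`, then `q`, if the target of `p` is the source of `q`,
and zero otherwise. -/
noncomputable def pathMul (p q : AllPaths Q) : PathAlgebra k Q :=
  if h : p.2.1 = q.1 then path k ((p.2.2.cast rfl h).comp q.2.2) else 0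

/-- The multiplication of the path algebra, the bilinear extension of the product of paths. -/
noncomputable def mulBilin : PathAlgebra k Q →ₗ[k] PathAlgebra k Q →ₗ[k] PathAlgebra k Q :=
  lift k fun p => lift k fun q => pathMul k p q

noncomputable instance : Mul (PathAlgebra k Q) := ⟨fun x y => mulBilin x y⟩

lemma mul_def (x y : PathAlgebra k Q) : x * y = mulBilin x y := rfl

lemma path_mul_path {a b c : Q} (p : Quiver.Path a b) (q : Quiver.Path b c) :
    path k p * path k q = path k (p.comp q) := by
  simp [mul_def, mulBilin, pathMul]

lemma path_mul_path_of_ne {a b c d : Q} (p : Quiver.Path a b) (q : Quiver.Path c d)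
    (h : b ≠ c) : path k p * path k q = 0 := by
  simp [mul_def, mulBilin, pathMul, h]

lemma zero_mul' (x : PathAlgebra k Q) : 0 * x = 0 := by simp [mul_def]

lemma mul_zero' (x : PathAlgebra k Q) : x * 0 = 0 := by simp [mul_def]

lemma path_mul_assoc {a b c d e f : Q} (p : Quiver.Path a b) (q : Quiver.Path c d)
    (r : Quiver.Path e f) :
    path k p * path k q * path k r = path k p * (path k q * path k r) := by
  by_cases h₁ : b = c
  · subst h₁
    by_cases h₂ : d = e
    · subst h₂
      simp [path_mul_path]
    · rw [path_mul_path, path_mul_path_of_ne _ _ h₂, path_mul_path_of_ne _ _ h₂, mul_zero']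
  · rw [path_mul_path_of_ne _ _ h₁, zero_mul']
    by_cases h₂ : d = e
    · subst h₂
      rw [path_mul_path, path_mul_path_of_ne _ _ h₁]
    · rw [path_mul_path_of_ne _ _ h₂, mul_zero']

lemma mul_assoc' (x y z : PathAlgebra k Q) : x * y * z = x * (y * z) := by
  have h : LinearMap.llcomp k (PathAlgebra k Q) _ _ mulBilin ∘ₗ mulBilin =
      (LinearMap.llcomp k (PathAlgebra k Q) _ _).flip mulBilin ∘ₗ
        LinearMap.llcomp k (PathAlgebra k Q) _ _ ∘ₗ mulBilin (k := k) (Q := Q) := by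
    refine lin_ext fun a b p => lin_ext fun c d q => lin_ext fun e f r => ?_
    exact path_mul_assoc p q r
  exact congrArg (fun f => f x y z) h

noncomputable instance [Fintype Q] : One (PathAlgebra k Q) := ⟨∑ a : Q, triv k a⟩

lemma one_def [Fintype Q] : (1 : PathAlgebra k Q) = ∑ a : Q, triv k a := rfl

lemma one_mul' [Fintype Q] (x : PathAlgebra k Q) : 1 * x = x := by
  classical
  have h : mulBilin (1 : PathAlgebra k Q) = LinearMap.id := by
    refine lin_ext fun a b p => ?_
    rw [one_def, map_sum, LinearMap.sum_apply, Finset.sum_eq_single a]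
    · exact (path_mul_path (k := k) Quiver.Path.nil p).trans (by simp)
    · exact fun c _ hc => path_mul_path_of_ne _ _ hc
    · simp
  exact congrArg (fun f => f x) h

lemma mul_one' [Fintype Q] (x : PathAlgebra k Q) : x * 1 = x := by
  classical
  have h : mulBilin.flip (1 : PathAlgebra k Q) = LinearMap.id := by
    refine lin_ext fun a b p => ?_
    rw [one_def, map_sum, LinearMap.sum_apply, Finset.sum_eq_single b]
    · exact path_mul_path (k := k) p Quiver.Path.nil
    · intro c _ hc
      exact path_mul_path_of_ne (k := k) p (Quiver.Path.nil : Quiver.Path c c) (Ne.symm hc)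
    · simp
  exact congrArg (fun f => f x) h

noncomputable instance [Fintype Q] : Ring (PathAlgebra k Q) where
  __ := (inferInstance : AddCommGroup (PathAlgebra k Q))
  mul := (· * ·)
  one := 1
  mul_assoc := mul_assoc'
  one_mul := one_mul'
  mul_one := mul_one'
  zero_mul := zero_mul'
  mul_zero := mul_zero'
  left_distrib x y z := by simp [mul_def]
  right_distrib x y z := by simp [mul_def]

noncomputable instance [Fintype Q] : Algebra k (PathAlgebra k Q) :=
  Algebra.ofModule (fun c x y => by simp [mul_def]) (fun c x y => by simp [mul_def])

end

/-! ## Admissible ideals and bound quiver algebras -/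

section

variable {k : Type w} {Q : Type u} [Field k] [Quiver.{v} Q] [Fintype Q]

/-- An ideal of the path algebra is admissible if every path that occurs in one of its elements
has length at least two, and for some `N > 1` it contains all paths of length `N`. -/
def IsAdmissible (I : TwoSidedIdeal (PathAlgebra k Q)) : Prop :=
  (∀ x ∈ I, ∀ p : AllPaths Q, coeff x p ≠ 0 → 2 ≤ p.2.2.length) ∧
    ∃ N : ℕ, 1 < N ∧ ∀ (a b : Q) (p : Quiver.Path a b), p.length = N → path k p ∈ I

/-- The quotient algebra `kQ / I`. -/
abbrev QuotAlgebra (I : TwoSidedIdeal (PathAlgebra k Q)) : Type (max u v w) :=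
  I.ringCon.Quotient

/-- The residue class in `kQ / I` of an element of `kQ`. -/
noncomputable def mk (I : TwoSidedIdeal (PathAlgebra k Q)) (x : PathAlgebra k Q) : QuotAlgebra I :=
  I.ringCon.mk' x

/-- The idempotent of `kQ / I` given by a vertex. -/
noncomputable def vertexIdem (I : TwoSidedIdeal (PathAlgebra k Q)) (a : Q) : QuotAlgebra I :=
  mk I (triv k a)

end

end PathAlgebra

/-! ## Homological notions -/

section Ring

/-- The left module `R e`. -/
abbrev leftPrincipal {R : Type u} [Ring R] (e : R) : Submodule R R :=
  Submodule.span R {e}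

/-- The right module `e R`; right modules are modules over the opposite ring. -/
abbrev rightPrincipal {R : Type u} [Ring R] (e : R) : Submodule Rᵐᵒᵖ R :=
  Submodule.span Rᵐᵒᵖ {e}

/-- The little finitistic dimension: the supremum of the projective dimensions of the finitely
generated left modules of finite projective dimension. -/
noncomputable def littleFinitisticDim (R : Type u) [Ring R] : WithBot ℕ∞ :=
  ⨆ (X : ModuleCat.{u} R) (_ : Module.Finite R X)
    (_ : CategoryTheory.projectiveDimension X < ⊤), CategoryTheory.projectiveDimension X

/-- The big finitistic dimension: the supremum of the projective dimensions of all left modules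
of finite projective dimension. -/
noncomputable def bigFinitisticDim (R : Type u) [Ring R] : WithBot ℕ∞ :=
  ⨆ (X : ModuleCat.{u} R) (_ : CategoryTheory.projectiveDimension X < ⊤),
    CategoryTheory.projectiveDimension X

/-- The (left) global dimension. -/
noncomputable def globalDim (R : Type u) [Ring R] : WithBot ℕ∞ :=
  ⨆ X : ModuleCat.{u} R, CategoryTheory.projectiveDimension X

/-- A submodule is superfluous if it has no proper supplement. -/
def Submodule.IsSuperfluous {R : Type u} [Ring R] {X : Type m} [AddCommGroup X] [Module R X]
    (N : Submodule R X) : Prop :=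
  ∀ L : Submodule R X, N ⊔ L = ⊤ → L = ⊤

/-- A minimal projective resolution `⋯ → P 1 → P 0 → X → 0` of a module: an exact sequence in which
every `P n` is projective and is a projective cover of its image. -/
structure MinimalProjectiveResolution (R : Type u) [Ring R] (X : Type m) [AddCommGroup X]
    [Module R X] where
  /-- the terms -/
  P : ℕ → Type m
  [addCommGroup : ∀ n, AddCommGroup (P n)]
  [module : ∀ n, Module R (P n)]
  projective : ∀ n, Module.Projective R (P n)
  /-- the augmentation -/
  aug : P 0 →ₗ[R] X
  /-- the differentials -/
  d : ∀ n, P (n + 1) →ₗ[R] P n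
  aug_surjective : Function.Surjective aug
  exact_zero : Function.Exact (d 0) aug
  exact_succ : ∀ n, Function.Exact (d (n + 1)) (d n)
  ker_aug : (LinearMap.ker aug).IsSuperfluous
  ker_d : ∀ n, (LinearMap.ker (d n)).IsSuperfluous

attribute [instance] MinimalProjectiveResolution.addCommGroup MinimalProjectiveResolution.module

variable {R : Type u} [Ring R] {ι : Type v} (e : ι → R)

/-- The support of a left module with respect to a family of idempotents. -/
def leftSupport (X : Type m) [AddCommGroup X] [Module R X] : Set ι :=
  {i | ∃ x : X, e i • x ≠ 0}

/-- The homological support, read off a minimal projective resolution of a right module: the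
indices `i` such that `e i R` is isomorphic to a direct summand of some term. -/
def rightHomologicalSupport {X : Type m} [AddCommGroup X] [Module Rᵐᵒᵖ X]
    (P : MinimalProjectiveResolution Rᵐᵒᵖ X) : Set ι :=
  {i | ∃ n, ∃ (s : rightPrincipal (e i) →ₗ[Rᵐᵒᵖ] P.P n) (r : P.P n →ₗ[Rᵐᵒᵖ] rightPrincipal (e i)),
    r ∘ₗ s = LinearMap.id}

/-- The right projective dimension of the bimodule `X` is strongly finite, with respect to a basic
set `e` of primitive orthogonal idempotents of a perfect ring `R`: it is finite, and the support of
`X` as a left module is disjoint from the homological support of `X` as a right module. (Over such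
a ring a minimal projective resolution exists and is unique up to isomorphism.) -/
def HasStronglyFiniteRightPD (X : Type m) [AddCommGroup X] [Module R X] [Module Rᵐᵒᵖ X] : Prop :=
  CategoryTheory.projectiveDimension (ModuleCat.of Rᵐᵒᵖ X) < ⊤ ∧
    ∃ P : MinimalProjectiveResolution Rᵐᵒᵖ X,
      leftSupport e X ∩ rightHomologicalSupport e P = ∅

end Ring

/-! ## The bimodule `W ⊗ N` of a left module `W` and a right module `N` -/

section Outer

/-- The tensor product over `k` of a left `A`-module `W` and a right `A`-module `N`, with its
structure of an `A`-bimodule. -/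
def OuterTensor (k : Type w) [Field k] (W : Type u) (N : Type v) [AddCommGroup W] [Module k W]
    [AddCommGroup N] [Module k N] : Type (max u v) :=
  W ⊗[k] N

namespace OuterTensor

variable {k : Type w} [Field k] {W : Type u} {N : Type v} [AddCommGroup W] [Module k W]
  [AddCommGroup N] [Module k N]

noncomputable instance : AddCommGroup (OuterTensor k W N) :=
  inferInstanceAs (AddCommGroup (W ⊗[k] N))

variable (k) in
/-- Pure tensors. -/
def tmul (x : W) (y : N) : OuterTensor k W N := x ⊗ₜ[k] y

@[elab_as_elim]
lemma induction_on {motive : OuterTensor k W N → Prop} (t : OuterTensor k W N)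
    (zero : motive 0) (tmul : ∀ x y, motive (tmul k x y))
    (add : ∀ s t, motive s → motive t → motive (s + t)) : motive t :=
  TensorProduct.induction_on (motive := motive) t zero tmul add

section

variable {A : Type m} [Ring A] [Algebra k A] [Module A W] [IsScalarTower k A W]

noncomputable instance : Module A (OuterTensor k W N) :=
  Module.compHom (W ⊗[k] N)
    ((Module.End.rTensorAlgHom k W N).comp (Algebra.lsmul k k W) : A →ₐ[k] _).toRingHom

lemma smul_tmul (a : A) (x : W) (y : N) : a • tmul k x y = tmul k (a • x) y := rfl

end

section

variable {A : Type m} [Ring A] [Algebra k A] [Module Aᵐᵒᵖ N] [IsScalarTower k Aᵐᵒᵖ N]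

noncomputable instance : Module Aᵐᵒᵖ (OuterTensor k W N) :=
  Module.compHom (W ⊗[k] N)
    ((Module.End.lTensorAlgHom k N W).comp (Algebra.lsmul k k N) : Aᵐᵒᵖ →ₐ[k] _).toRingHom

lemma op_smul_tmul (a : Aᵐᵒᵖ) (x : W) (y : N) : a • tmul k x y = tmul k x (a • y) := rfl

end

noncomputable instance : Module k (OuterTensor k W N) :=
  inferInstanceAs (Module k (W ⊗[k] N))

variable {A : Type m} [Ring A] [Algebra k A] [Module A W] [IsScalarTower k A W]
  [Module Aᵐᵒᵖ N] [IsScalarTower k Aᵐᵒᵖ N]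

instance : SMulCommClass A Aᵐᵒᵖ (OuterTensor k W N) where
  smul_comm a b t := by
    induction t using induction_on with
    | zero => simp
    | tmul x y => simp only [smul_tmul, op_smul_tmul]
    | add s t hs ht => simp only [smul_add, hs, ht]

instance : IsScalarTower k A (OuterTensor k W N) where
  smul_assoc c a t := by
    induction t using induction_on with
    | zero => simp
    | tmul x y =>
      rw [smul_tmul, smul_tmul, smul_assoc]
      exact (TensorProduct.smul_tmul' c (a • x) y).symm
    | add s t hs ht => simp only [smul_add, hs, ht]

instance : IsScalarTower k Aᵐᵒᵖ (OuterTensor k W N) where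
  smul_assoc c a t := by
    induction t using induction_on with
    | zero => simp
    | tmul x y =>
      rw [op_smul_tmul, op_smul_tmul, smul_assoc]
      exact TensorProduct.tmul_smul c x (a • y)
    | add s t hs ht => simp only [smul_add, hs, ht]

end OuterTensor

end Outer

/-! ## Trivial one-arrow extensions -/

section OneArrow

/-- The vertices of the quiver obtained from `Q` by adding one arrow `i ⟶ j`. -/
def AddArrow (Q : Type u) (_i _j : Q) : Type u := Q

namespace AddArrow

variable {Q : Type u} [Quiver.{v} Q] (i j : Q)

/-- The arrows are the arrows of `Q` and exactly one new arrow `i ⟶ j`. -/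
instance : Quiver.{v} (AddArrow Q i j) where
  Hom a b := ((show Q from a) ⟶ (show Q from b)) ⊕ PLift (a = i ∧ b = j)

instance [Fintype Q] : Fintype (AddArrow Q i j) := inferInstanceAs (Fintype Q)

/-- The inclusion of `Q` into the larger quiver. -/
def incl : Q ⥤q AddArrow Q i j where
  obj a := a
  map f := Sum.inl f

/-- The new arrow. -/
def newArrow : (incl i j).obj i ⟶ (incl i j).obj j := Sum.inr ⟨rfl, rfl⟩

variable (k : Type w) [Field k]

/-- The linear map from `kQ` to the path algebra of the larger quiver sending every path to
itself. -/
noncomputable def inclAlg : PathAlgebra k Q →ₗ[k] PathAlgebra k (AddArrow Q i j) :=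
  PathAlgebra.lift k fun p => PathAlgebra.path k ((incl i j).mapPath p.2.2)

/-- The new arrow as an element of the path algebra. -/
noncomputable def newArrowAlg : PathAlgebra k (AddArrow Q i j) :=
  PathAlgebra.path k (newArrow i j).toPath

end AddArrow

variable {k : Type w} [Field k] {Q : Type u} [Quiver.{v} Q] [Fintype Q]
  (I : TwoSidedIdeal (PathAlgebra k Q)) (i j : Q)

open PathAlgebra AddArrow

/-- The ideal generated by `I` and all `z α`, where `α` is the new arrow and `z` is an element of
`kQ e_i` whose residue class lies in `V`. -/
noncomputable def oneArrowIdeal (V : Submodule (QuotAlgebra I) (leftPrincipal (vertexIdem I i))) :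
    TwoSidedIdeal (PathAlgebra k (AddArrow Q i j)) :=
  TwoSidedIdeal.span
    (inclAlg i j k '' {z | z ∈ I} ∪
      {y | ∃ z : PathAlgebra k Q, z * triv k i = z ∧ (∃ x ∈ V, (x : QuotAlgebra I) = mk I z) ∧
        y = inclAlg i j k z * newArrowAlg i j k})

/-- The bimodule `(Γ e_i / V) ⊗ e_j Γ`, where `Γ = kQ / I`. -/
abbrev oneArrowBimodule (V : Submodule (QuotAlgebra I) (leftPrincipal (vertexIdem I i))) :
    Type (max u v w) :=
  OuterTensor k (leftPrincipal (vertexIdem I i) ⧸ V) (rightPrincipal (vertexIdem I j))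

end OneArrow

/-! ## Projective dimension and kernels of surjections from projective modules -/

section ProjectiveDimension

open CategoryTheory

/-! Write `R` for `Γ`, `W` for `Γ e_i / V`, and `S` for the one-arrow extension. Since every product
`z α` with `z` in `V` vanishes in `S`, and `e_j Γ e_i ⊆ V` makes any product containing `α` twice
vanish, `S` is the trivial extension `R ⋉ M` with `M = W ⊗ e_j R`; the new arrow corresponds to the
class of `e_i` tensored with `e_j` (`AddArrow.equivTrivExt`).

The inclusion `e_j R e_i ⊆ V` also gives `e_j W = 0`. Hence `e_j M = 0` and `e_j S = e_j R`, so the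
square-zero ideal `M` is a direct sum of `dim W` copies of `e_j S`: it is projective as a right
`S`-module, not only as a right `R`-module. `SplitExtension` axiomatizes this situation. For a left
`S`-module `Y` the only obstruction to exact reduction is `Tor_1(R, Y)`, the kernel of the
multiplication map from a sum of copies of `e_j Y` to `Y`; it vanishes exactly for the modules that
satisfy `IsTorFree`.

For torsion-free `Y` one has `pd_S Y = pd_R (Y / M Y)` (`IsTorFree.hasProjectiveDimensionLE_iff`):
syzygies of `Y` reduce to syzygies of `Y / M Y` (`isReduction_kerMap`), and `Y` is projective iff `Y
/ M Y` is, by Nakayama and lifting of idempotents modulo `M`, where `M² = 0`. Every `R`-module `X`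
is the reduction of the torsion-free module `S ⊗_R X` (`hasLifts_splitExtension`), so each dimension
of `R` is at most that of `S`. Conversely, a first syzygy over `S` lies in a free module and is
therefore torsion-free, so each dimension of `S` is at most one more than that of `R`.

Strong finiteness holds because `M` is right projective and so is its own minimal resolution: only
`e_j R` occurs in it, while `e_j M = 0`. -/

lemma hasProjectiveDimensionLE_succ_iff_ker {R : Type u} [Ring R] {F Y : Type u} [AddCommGroup F]
    [Module R F] [AddCommGroup Y] [Module R Y] [Module.Projective R F] (p : F →ₗ[R] Y)
    (hp : Function.Surjective p) (n : ℕ) :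
    HasProjectiveDimensionLE (ModuleCat.of R Y) (n + 1) ↔
      HasProjectiveDimensionLE (ModuleCat.of R (LinearMap.ker p)) n := by
  let S : ShortComplex (ModuleCat.{u} R) :=
    ShortComplex.mk (ModuleCat.ofHom (LinearMap.ker p).subtype) (ModuleCat.ofHom p)
      (by ext x; exact x.2)
  have hS : S.ShortExact :=
    { exact := (ShortComplex.ShortExact.moduleCat_exact_iff_function_exact S).mpr fun x =>
        ⟨fun hx => ⟨⟨x, hx⟩, rfl⟩, by rintro ⟨y, rfl⟩; exact y.2⟩
      mono_f := (ModuleCat.mono_iff_injective _).mpr Subtype.val_injective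
      epi_g := (ModuleCat.epi_iff_surjective _).mpr hp }
  exact hS.hasProjectiveDimensionLT_X₃_iff n ((IsProjective.iff_projective F).mp inferInstance)

lemma hasProjectiveDimensionLE_zero_iff_projective {R : Type u} [Ring R] {Y : Type u}
    [AddCommGroup Y] [Module R Y] :
    HasProjectiveDimensionLE (ModuleCat.of R Y) 0 ↔ Module.Projective R Y := by
  rw [IsProjective.iff_projective (R := R) Y, projective_iff_hasProjectiveDimensionLE_zero]

lemma projectiveDimension_lt_top_iff {C : Type*} [Category C] [Abelian C] (X : C) :
    projectiveDimension X < ⊤ ↔ ∃ n, HasProjectiveDimensionLE X n := by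
  rw [lt_top_iff_ne_top, projectiveDimension_ne_top_iff]

lemma WithBot.iSup_lt_top_iff {ι : Sort*} (f : ι → WithBot ℕ∞) :
    ⨆ i, f i < ⊤ ↔ ∃ n : ℕ, ∀ i, f i ≤ n := by
  constructor
  · intro h
    generalize ht : ⨆ i, f i = t at h
    have hle : ∀ i, f i ≤ t := fun i => ht ▸ le_iSup f i
    induction t with
    -- Here every value is `⊥`, so any bound serves.
    | bot => exact ⟨0, fun i => (hle i).trans bot_le⟩
    | coe t =>
      induction t with
      | top => exact absurd h (lt_irrefl _)
      | coe n => exact ⟨n, hle⟩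
  · rintro ⟨n, h⟩
    refine (iSup_le h).trans_lt ?_
    exact WithBot.coe_lt_coe.mpr (ENat.natCast_lt_top n)

lemma littleFinitisticDim_lt_top_iff (R : Type u) [Ring R] :
    littleFinitisticDim R < ⊤ ↔ ∃ n : ℕ, ∀ X : ModuleCat.{u} R, Module.Finite R X →
      (∃ l, HasProjectiveDimensionLE X l) → HasProjectiveDimensionLE X n := by
  simp only [littleFinitisticDim, WithBot.iSup_lt_top_iff, iSup_le_iff,
    projectiveDimension_lt_top_iff, projectiveDimension_le_iff]

lemma bigFinitisticDim_lt_top_iff (R : Type u) [Ring R] :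
    bigFinitisticDim R < ⊤ ↔ ∃ n : ℕ, ∀ X : ModuleCat.{u} R,
      (∃ l, HasProjectiveDimensionLE X l) → HasProjectiveDimensionLE X n := by
  simp only [bigFinitisticDim, WithBot.iSup_lt_top_iff, iSup_le_iff,
    projectiveDimension_lt_top_iff, projectiveDimension_le_iff]

lemma globalDim_lt_top_iff (R : Type u) [Ring R] :
    globalDim R < ⊤ ↔ ∃ n : ℕ, ∀ X : ModuleCat.{u} R, HasProjectiveDimensionLE X n := by
  simp only [globalDim, WithBot.iSup_lt_top_iff, projectiveDimension_le_iff]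

end ProjectiveDimension

/-! ## Split extensions by a square-zero ideal that is projective on the right -/

/-- A split surjection of rings whose kernel has square zero and is, as a right module, a direct
sum of copies of `idem * S`, with the family `gen` as generators of the summands. -/
structure SplitExtension (S R : Type u) [Ring S] [Ring R] (β : Type m) [Fintype β] where
  proj : S →+* R
  sec : R →+* S
  proj_sec : ∀ r, proj (sec r) = r
  idem : S
  idem_mul_idem : idem * idem = idem
  gen : β → S
  gen_mul_idem : ∀ b, gen b * idem = gen b
  proj_gen : ∀ b, proj (gen b) = 0
  gen_mul_gen : ∀ b c x, gen b * (x * gen c) = 0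
  exists_eq_sum : ∀ x, proj x = 0 → ∃ z : β → S, x = ∑ b, gen b * z b
  eq_zero : ∀ z : β → S, (∀ b, idem * z b = z b) → ∑ b, gen b * z b = 0 → ∀ b, z b = 0

namespace SplitExtension

variable {S R : Type u} [Ring S] [Ring R] {β : Type m} [Fintype β] (D : SplitExtension S R β)

/-- The multiplication map from the tensor product of the kernel with `Y` to `Y` is injective. -/
def IsTorFree (Y : Type*) [AddCommGroup Y] [Module S Y] : Prop :=
  ∀ y : β → Y, (∀ b, D.idem • y b = y b) → ∑ b, D.gen b • y b = 0 → ∀ b, y b = 0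

/-- A map that identifies `X` with the quotient of `Y` by the kernel times `Y`. -/
def IsReduction {Y X : Type*} [AddCommGroup Y] [Module S Y] [AddCommGroup X] [Module R X]
    (π : Y →ₛₗ[D.proj] X) : Prop :=
  Function.Surjective π ∧ ∀ y, π y = 0 → ∃ z : β → Y, y = ∑ b, D.gen b • z b

section

variable {Y X : Type*} [AddCommGroup Y] [Module S Y] [AddCommGroup X] [Module R X]

lemma map_sum_gen_smul (π : Y →ₛₗ[D.proj] X) (z : β → Y) : π (∑ b, D.gen b • z b) = 0 := by
  simp [map_sum, D.proj_gen]

lemma sum_gen_smul_idem_smul (z : β → Y) :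
    ∑ b, D.gen b • D.idem • z b = ∑ b, D.gen b • z b := by
  simp only [smul_smul, D.gen_mul_idem]

variable {D}

/-- Normalizes the coefficients to lie in `idem Y`, as `IsTorFree` demands; this is harmless because
`gen b * idem = gen b`. -/
lemma IsReduction.exists_idem {π : Y →ₛₗ[D.proj] X} (hπ : D.IsReduction π) {y : Y}
    (hy : π y = 0) :
    ∃ z : β → Y, (∀ b, D.idem • z b = z b) ∧ y = ∑ b, D.gen b • z b := by
  obtain ⟨z, rfl⟩ := hπ.2 y hy
  exact ⟨fun b => D.idem • z b, fun b => by rw [smul_smul, D.idem_mul_idem],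
    (D.sum_gen_smul_idem_smul z).symm⟩

lemma IsReduction.gen_smul_eq_zero {π : Y →ₛₗ[D.proj] X} (hπ : D.IsReduction π) {y : Y}
    (hy : π y = 0) (b : β) : D.gen b • y = 0 := by
  obtain ⟨z, rfl⟩ := hπ.2 y hy
  simp only [Finset.smul_sum, smul_smul]
  refine Finset.sum_eq_zero fun c _ => ?_
  have := D.gen_mul_gen b c 1
  rw [one_mul] at this
  rw [this, zero_smul]

/-- Passing to submodules is what makes every syzygy torsion-free, whatever the module it comes
from. -/
lemma IsTorFree.of_injective {Z : Type*} [AddCommGroup Z] [Module S Z] (hY : D.IsTorFree Y)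
    (f : Z →ₗ[S] Y) (hf : Function.Injective f) : D.IsTorFree Z := by
  intro z hz h b
  refine hf ((hY (fun b => f (z b)) (fun b => ?_) ?_ b).trans (map_zero f).symm)
  · rw [← map_smul, hz]
  · rw [← map_zero f, ← h, map_sum]
    simp only [map_smul]

/-- Nakayama: a map into `Y` that is surjective modulo the kernel is surjective. -/
lemma IsReduction.surjective_of_comp {Z : Type*} [AddCommGroup Z] [Module S Z]
    {π : Y →ₛₗ[D.proj] X} (hπ : D.IsReduction π) (p : Z →ₗ[S] Y)
    (h : ∀ y, ∃ z, π (p z) = π y) : Function.Surjective p := by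
  have key : ∀ y, ∃ z, ∃ t, y = p z + t ∧ π t = 0 := fun y => by
    obtain ⟨z, hz⟩ := h y
    exact ⟨z, y - p z, by abel, by rw [map_sub, hz, sub_self]⟩
  intro y
  obtain ⟨z, t, rfl, ht⟩ := key y
  obtain ⟨s, rfl⟩ := hπ.2 t ht
  -- The coefficients `s b` need only be hit modulo the kernel: the errors `c b` are annihilated by
  -- `gen b`, since the kernel has square zero.
  choose a c hac hc using fun b => key (s b)
  refine ⟨z + ∑ b, D.gen b • a b, ?_⟩
  rw [map_add, map_sum]
  congr 1
  refine Finset.sum_congr rfl fun b _ => ?_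
  conv_rhs => rw [hac b, smul_add, hπ.gen_smul_eq_zero (hc b), add_zero]
  rw [map_smul]

end

/-! ### Free modules -/

section Free

variable (ι : Type*)

/-- The reduction of a free module. -/
noncomputable def freeMap : (ι →₀ S) →ₛₗ[D.proj] (ι →₀ R) where
  toFun := Finsupp.mapRange D.proj (map_zero _)
  map_add' f g := by ext; simp
  map_smul' c f := by ext; simp

@[simp] lemma freeMap_apply (f : ι →₀ S) (a : ι) : D.freeMap ι f a = D.proj (f a) := rfl

lemma isReduction_freeMap : D.IsReduction (D.freeMap ι) := by
  classical
  constructor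
  · intro f
    refine ⟨f.mapRange D.sec (map_zero _), ?_⟩
    ext a
    simp [D.proj_sec]
  · intro f hf
    have h : ∀ a, ∃ z : β → S, f a = ∑ b, D.gen b * z b := fun a =>
      D.exists_eq_sum _ (by rw [← D.freeMap_apply, hf]; rfl)
    choose z hz using h
    -- The coefficients chosen where `f a = 0` may be nonzero; they are replaced by zero to keep the
    -- support finite.
    refine ⟨fun b => Finsupp.onFinset f.support (fun a => if f a = 0 then 0 else z a b) ?_, ?_⟩
    · intro a ha
      rw [Finsupp.mem_support_iff]
      intro h
      simp [h] at ha
    · ext a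
      rw [Finsupp.finsetSum_apply]
      by_cases h : f a = 0
      · simp [h]
      · simp only [Finsupp.smul_apply, Finsupp.onFinset_apply, if_neg h, smul_eq_mul]
        exact hz a

lemma isTorFree_free : D.IsTorFree (ι →₀ S) := by
  intro z hz h b
  ext a
  refine D.eq_zero (fun b => z b a) (fun b => ?_) ?_ b
  · conv_rhs => rw [← hz b]
    rfl
  · have := DFunLike.congr_fun h a
    rwa [Finsupp.finsetSum_apply] at this

end Free

/-! ### Syzygies and their reductions -/

section Cover

variable {D} {Y X : Type*} [AddCommGroup Y] [Module S Y] [AddCommGroup X] [Module R X]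
  (π : Y →ₛₗ[D.proj] X)

lemma map_linearCombination {ι : Type*} (v : ι → Y) (f : ι →₀ S) :
    π (Finsupp.linearCombination S v f) =
      Finsupp.linearCombination R (fun a => π (v a)) (D.freeMap ι f) := by
  induction f using Finsupp.induction_linear with
  | zero => simp
  | add f g hf hg => simp only [map_add, hf, hg]
  | single a s =>
    have : D.freeMap ι (Finsupp.single a s) = Finsupp.single a (D.proj s) := by
      classical
      ext c
      rw [freeMap_apply, Finsupp.single_apply, Finsupp.single_apply]
      split_ifs <;> simp
    rw [this, Finsupp.linearCombination_single, Finsupp.linearCombination_single, map_smulₛₗ]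

variable {F E : Type*} [AddCommGroup F] [Module S F] [AddCommGroup E] [Module R E]
  {ρ : F →ₛₗ[D.proj] E} {p : F →ₗ[S] Y} {q : E →ₗ[R] X}

/-- The map induced on kernels by a commutative square. -/
def kerMap (h : ∀ f, π (p f) = q (ρ f)) : LinearMap.ker p →ₛₗ[D.proj] LinearMap.ker q where
  toFun f := ⟨ρ f, by rw [LinearMap.mem_ker, ← h, f.2, map_zero]⟩
  map_add' f g := Subtype.ext (map_add ρ _ _)
  map_smul' c f := Subtype.ext (map_smulₛₗ ρ _ _)

variable {π}

/-- With `J = ker proj`, this says `ker p ∩ J F = J (ker p)`, the vanishing of `Tor_1` in elementary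
form: `p` carries an expression with coefficients in `idem F` to a relation in `Y`, and
torsion-freeness makes that relation trivial. -/
lemma exists_ker_of_map_eq_zero (hY : D.IsTorFree Y) (hρ : D.IsReduction ρ)
    {f : F} (hf : p f = 0) (hf' : ρ f = 0) :
    ∃ z : β → F, (∀ b, p (z b) = 0) ∧ f = ∑ b, D.gen b • z b := by
  obtain ⟨z, hz, rfl⟩ := hρ.exists_idem hf'
  refine ⟨z, hY (fun b => p (z b)) (fun b => ?_) ?_, rfl⟩
  · rw [← map_smul, hz]
  · simpa only [map_sum, map_smul] using hf

/-- Reduction of `0 → ker p → F → Y → 0` stays exact because `Y` has no torsion. -/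
lemma isReduction_kerMap (hY : D.IsTorFree Y) (hπ : D.IsReduction π) (hρ : D.IsReduction ρ)
    (hp : Function.Surjective p) (h : ∀ f, π (p f) = q (ρ f)) :
    D.IsReduction (kerMap π h) := by
  constructor
  · rintro ⟨e, he⟩
    obtain ⟨f, rfl⟩ := hρ.1 e
    rw [LinearMap.mem_ker, ← h] at he
    -- A lift `f` of `e` is mapped by `p` into the kernel times `Y`. Subtracting an element of the
    -- kernel times `F` with the same image puts it into `ker p` without changing its reduction.
    obtain ⟨y, hy⟩ := hπ.2 _ he
    choose g hg using fun b => hp (y b)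
    refine ⟨⟨f - ∑ b, D.gen b • g b, ?_⟩, ?_⟩
    · rw [LinearMap.mem_ker, map_sub, map_sum, hy, sub_eq_zero]
      simp only [map_smul, hg]
    · refine Subtype.ext ?_
      change ρ _ = _
      rw [map_sub, D.map_sum_gen_smul, sub_zero]
  · rintro ⟨f, hf⟩ hf'
    obtain ⟨z, hz, rfl⟩ := exists_ker_of_map_eq_zero hY hρ hf (congrArg Subtype.val hf')
    refine ⟨fun b => ⟨z b, hz b⟩, Subtype.ext ?_⟩
    simp

end Cover

end SplitExtension

namespace SplitExtension

variable {S R : Type u} [Ring S] [Ring R] {β : Type m} [Fintype β] {D : SplitExtension S R β}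

/-! ### Projectivity before and after reduction -/

section Projective

variable {Y X : Type*} [AddCommGroup Y] [Module S Y] [AddCommGroup X] [Module R X]
  {π : Y →ₛₗ[D.proj] X}

/-- Reduction is base change along `proj`. A lifting problem for `X`, regarded over `S`, is solved
on `Y`; the solution kills the kernel times `Y` because its target is an `R`-module, so it descends
to `X`. -/
lemma IsReduction.projective_of_projective (hπ : D.IsReduction π) [Module.Projective S Y] :
    Module.Projective R X := by
  refine Module.Projective.of_lifting_property'' fun f hf => ?_
  let : Module S X := Module.compHom X D.proj
  let : Module S (X →₀ R) := Module.compHom (X →₀ R) D.proj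
  let f' : (X →₀ R) →ₗ[S] X := { f with map_smul' := fun c x => f.map_smul (D.proj c) x }
  let π' : Y →ₗ[S] X := { π with map_smul' := fun c x => π.map_smulₛₗ c x }
  obtain ⟨h, hh⟩ := Module.projective_lifting_property f' π' hf
  have hh' : ∀ y, f (h y) = π y := fun y => LinearMap.congr_fun hh y
  have h0 : ∀ y, π y = 0 → h y = 0 := fun y hy => by
    obtain ⟨z, rfl⟩ := hπ.2 y hy
    rw [map_sum]
    refine Finset.sum_eq_zero fun b _ => ?_
    rw [map_smul]
    change D.proj (D.gen b) • h (z b) = 0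
    rw [D.proj_gen, zero_smul]
  have h1 : ∀ y y', π y = π y' → h y = h y' := fun y y' e => by
    rw [← sub_eq_zero, ← map_sub]
    exact h0 _ (by rw [map_sub, e, sub_self])
  have hs := Function.rightInverse_surjInv hπ.1
  refine ⟨{ toFun := fun x => h (Function.surjInv hπ.1 x), map_add' := ?_, map_smul' := ?_ }, ?_⟩
  · intro x x'
    rw [← map_add]
    exact h1 _ _ (by rw [map_add, hs, hs, hs])
  · intro r x
    have : r • h (Function.surjInv hπ.1 x) = h (D.sec r • Function.surjInv hπ.1 x) := by
      refine Eq.trans ?_ (map_smul h _ _).symm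
      change _ = D.proj (D.sec r) • h (Function.surjInv hπ.1 x)
      rw [D.proj_sec]
    rw [RingHom.id_apply, this]
    exact h1 _ _ (by rw [map_smulₛₗ, hs, hs, D.proj_sec])
  · ext x
    exact (hh' _).trans (hs x)

/-- Lifting idempotents modulo elements of square zero. -/
lemma _root_.isIdempotentElem_of_sub_sq_eq_zero {A : Type*} [Ring A] (f : A)
    (h : (f * f - f) * (f * f - f) = 0) :
    IsIdempotentElem (f + (f * f - f) * (1 - 2 * f)) := by
  -- The element is `3f² - 2f³`, the usual Newton step for the equation `x² = x`.
  have e : (f + (f * f - f) * (1 - 2 * f)) * (f + (f * f - f) * (1 - 2 * f)) -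
      (f + (f * f - f) * (1 - 2 * f)) =
        ((f * f - f) * (f * f - f)) * (4 * (f * f) - 4 * f - 3) := by noncomm_ring
  rw [h, zero_mul] at e
  exact sub_eq_zero.mp e

/-- The idempotent `s ∘ q` of `E` lifts to an endomorphism `f` of `F`, which is corrected to an
idempotent `e`. Its range is a summand of `F`, and `p` maps it isomorphically onto `Y`: onto by
Nakayama, injectively by torsion-freeness. -/
lemma IsTorFree.projective_of_section {F E : Type*} [AddCommGroup F] [Module S F]
    [Module.Projective S F] [AddCommGroup E] [Module R E] {ρ : F →ₛₗ[D.proj] E} {p : F →ₗ[S] Y}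
    {q : E →ₗ[R] X} (hY : D.IsTorFree Y) (hπ : D.IsReduction π) (hρ : D.IsReduction ρ)
    (hp : Function.Surjective p) (hpq : ∀ f, π (p f) = q (ρ f)) (s : X →ₗ[R] E)
    (hs : ∀ x, q (s x) = x) (f : Module.End S F) (hf : ∀ t, ρ (f t) = s (q (ρ t))) :
    Module.Projective S Y := by
  have hg : ∀ t, ρ ((f * f - f) t) = 0 := fun t => by
    rw [LinearMap.sub_apply, map_sub, Module.End.mul_apply, hf, hf, hs, sub_self]
  -- An endomorphism with values in the kernel times `F` kills the kernel times `F`; hence `(f² -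
  -- f)² = 0`.
  have hgg : ∀ a : Module.End S F, (∀ t, ρ (a t) = 0) → ∀ t, ρ t = 0 → a t = 0 := by
    intro a ha t ht
    obtain ⟨z, rfl⟩ := hρ.2 t ht
    rw [map_sum]
    exact Finset.sum_eq_zero fun b _ => by rw [map_smul, hρ.gen_smul_eq_zero (ha _)]
  have he := isIdempotentElem_of_sub_sq_eq_zero f (LinearMap.ext fun t => hgg _ hg _ (hg t))
  set e : Module.End S F := f + (f * f - f) * (1 - 2 * f) with e_def
  have hee : ∀ t, e (e t) = e t := LinearMap.congr_fun he
  have hρe : ∀ t, ρ (e t) = s (q (ρ t)) := fun t => by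
    rw [e_def, LinearMap.add_apply, map_add, Module.End.mul_apply, hg, add_zero, hf]
  have : Module.Projective S (LinearMap.range e) :=
    Module.Projective.of_split (LinearMap.range e).subtype e.rangeRestrict
      (LinearMap.ext fun ⟨x, t, ht⟩ => Subtype.ext (by subst ht; exact hee t))
  have hinj : Function.Injective (p.domRestrict (LinearMap.range e)) := by
    rw [← LinearMap.ker_eq_bot, LinearMap.ker_eq_bot']
    rintro ⟨_, t, rfl⟩ ht
    have ht' : p (e t) = 0 := ht
    have h1 : ρ (e t) = 0 := by rw [← hee, hρe, ← hpq, ht', map_zero, map_zero]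
    -- Writing `e t` with coefficients in `ker p` and applying `e` once more moves each coefficient
    -- into the kernel times `F`, where `gen b` annihilates it.
    obtain ⟨z, hz, hz'⟩ := exists_ker_of_map_eq_zero hY hρ ht' h1
    refine Subtype.ext ?_
    change e t = 0
    rw [← hee, hz', map_sum]
    refine Finset.sum_eq_zero fun b _ => ?_
    rw [map_smul]
    exact hρ.gen_smul_eq_zero (by rw [hρe, ← hpq, hz, map_zero, map_zero]) b
  have hsurj : Function.Surjective (p.domRestrict (LinearMap.range e)) := by
    refine hπ.surjective_of_comp _ fun y => ?_
    obtain ⟨t, rfl⟩ := hp y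
    refine ⟨⟨e t, t, rfl⟩, ?_⟩
    change π (p (e t)) = _
    rw [hpq, hρe, hs, hpq]
  exact Module.Projective.of_equiv (LinearEquiv.ofBijective _ ⟨hinj, hsurj⟩)

lemma IsTorFree.projective_of_projective (hY : D.IsTorFree Y) (hπ : D.IsReduction π)
    [Module.Projective R X] : Module.Projective S Y := by
  let p : (Y →₀ S) →ₗ[S] Y := Finsupp.linearCombination S id
  let q : (Y →₀ R) →ₗ[R] X := Finsupp.linearCombination R π
  have hρ := D.isReduction_freeMap Y
  have hpq : ∀ f, π (p f) = q (D.freeMap Y f) := map_linearCombination π id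
  have hp : Function.Surjective p := Finsupp.linearCombination_id_surjective S Y
  have hq : Function.Surjective q := fun x => by
    obtain ⟨y, rfl⟩ := hπ.1 x
    obtain ⟨f, rfl⟩ := hp y
    exact ⟨D.freeMap Y f, (hpq f).symm⟩
  obtain ⟨s, hs⟩ := Module.projective_lifting_property q LinearMap.id hq
  -- The lift of `s ∘ q` is defined on the basis: the vector at `y` goes to a preimage of `s (π y)`
  -- in the free `S`-module.
  refine hY.projective_of_section hπ hρ hp hpq s (LinearMap.congr_fun hs)
    (Finsupp.linearCombination S fun y => Function.surjInv hρ.1 (s (π y))) fun t => ?_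
  rw [← hpq]
  change D.freeMap Y (Finsupp.linearCombination S _ t) = s (π (Finsupp.linearCombination S _ t))
  rw [map_linearCombination, map_linearCombination, Finsupp.apply_linearCombination]
  congr 2
  funext y
  exact Function.surjInv_eq hρ.1 _

end Projective

/-! ### Projective dimension under reduction and comparison of homological dimensions -/

section ProjectiveDimension

open CategoryTheory

/-- Reduction does not change the projective dimension of a module that has no torsion. -/
lemma IsTorFree.hasProjectiveDimensionLE_iff (n : ℕ) {Y X : Type u} [AddCommGroup Y]
    [Module S Y] [AddCommGroup X] [Module R X] {π : Y →ₛₗ[D.proj] X} (hY : D.IsTorFree Y)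
    (hπ : D.IsReduction π) :
    HasProjectiveDimensionLE (ModuleCat.of S Y) n ↔
      HasProjectiveDimensionLE (ModuleCat.of R X) n := by
  induction n generalizing Y X with
  | zero =>
    rw [hasProjectiveDimensionLE_zero_iff_projective, hasProjectiveDimensionLE_zero_iff_projective]
    exact ⟨fun _ => hπ.projective_of_projective, fun _ => hY.projective_of_projective hπ⟩
  | succ n ih =>
    let p : (Y →₀ S) →ₗ[S] Y := Finsupp.linearCombination S id
    let q : (Y →₀ R) →ₗ[R] X := Finsupp.linearCombination R π
    have hpq : ∀ f, π (p f) = q (D.freeMap Y f) := map_linearCombination π id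
    have hp : Function.Surjective p := Finsupp.linearCombination_id_surjective S Y
    have hq : Function.Surjective q := fun x => by
      obtain ⟨y, rfl⟩ := hπ.1 x
      obtain ⟨f, rfl⟩ := hp y
      exact ⟨D.freeMap Y f, (hpq f).symm⟩
    rw [hasProjectiveDimensionLE_succ_iff_ker p hp, hasProjectiveDimensionLE_succ_iff_ker q hq]
    exact ih ((D.isTorFree_free Y).of_injective _ (LinearMap.ker p).subtype_injective)
      (isReduction_kerMap hY hπ (D.isReduction_freeMap Y) hp hpq)

variable (D)

/-- The kernel of `proj` times `Y`. -/
def kerSMul (Y : Type*) [AddCommGroup Y] [Module S Y] : Submodule S Y where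
  carrier := {y | ∃ z : β → Y, y = ∑ b, D.gen b • z b}
  zero_mem' := ⟨0, by simp⟩
  add_mem' := by
    rintro _ _ ⟨z, rfl⟩ ⟨z', rfl⟩
    exact ⟨z + z', by simp [Finset.sum_add_distrib]⟩
  smul_mem' := by
    rintro c _ ⟨z, rfl⟩
    -- The kernel of `proj` is a left ideal too, so `c * gen b` expands again in the generators.
    choose a ha using fun b => D.exists_eq_sum (c * D.gen b) (by rw [map_mul, D.proj_gen, mul_zero])
    refine ⟨fun b' => ∑ b, a b b' • z b, ?_⟩
    simp only [Finset.smul_sum, smul_smul]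
    rw [Finset.sum_comm]
    refine Finset.sum_congr rfl fun b _ => ?_
    rw [← Finset.sum_smul, ← ha]

lemma exists_isReduction (Y : Type u) [AddCommGroup Y] [Module S Y] :
    ∃ (X : Type u) (_ : AddCommGroup X) (_ : Module R X) (π : Y →ₛₗ[D.proj] X),
      D.IsReduction π := by
  -- The section provides the `R`-structure; it agrees with the `S`-structure through `proj`, since
  -- `c - sec (proj c)` lies in the kernel and so kills the quotient.
  let : Module R (Y ⧸ D.kerSMul Y) := Module.compHom _ D.sec
  refine ⟨Y ⧸ D.kerSMul Y, inferInstance, inferInstance,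
    { (D.kerSMul Y).mkQ with map_smul' := fun c y => ?_ }, (D.kerSMul Y).mkQ_surjective,
    fun y hy => (Submodule.Quotient.mk_eq_zero _).mp hy⟩
  change (D.kerSMul Y).mkQ (c • y) = D.sec (D.proj c) • (D.kerSMul Y).mkQ y
  rw [← map_smul, ← sub_eq_zero, ← map_sub, ← sub_smul]
  obtain ⟨z, hz⟩ := D.exists_eq_sum (c - D.sec (D.proj c))
    (by rw [map_sub, D.proj_sec, sub_self])
  refine (Submodule.Quotient.mk_eq_zero _).mpr ⟨fun b => z b • y, ?_⟩
  rw [hz, Finset.sum_smul]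
  simp only [smul_smul]

lemma IsReduction.finite {Y X : Type*} [AddCommGroup Y] [Module S Y] [AddCommGroup X] [Module R X]
    {π : Y →ₛₗ[D.proj] X} (hπ : D.IsReduction π) [Module.Finite S Y] : Module.Finite R X := by
  classical
  obtain ⟨t, ht⟩ := Module.Finite.fg_top (R := S) (M := Y)
  refine ⟨t.image π, eq_top_iff.mpr fun x _ => ?_⟩
  obtain ⟨y, rfl⟩ := hπ.1 x
  have hy : y ∈ Submodule.span S (t : Set Y) := ht ▸ Submodule.mem_top
  induction hy using Submodule.span_induction with
  | mem y hy => exact Submodule.subset_span (by simpa using ⟨y, hy, rfl⟩)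
  | zero => rw [map_zero]; exact zero_mem _
  | add a b _ _ ha hb => rw [map_add]; exact add_mem (ha trivial) (hb trivial)
  | smul c a _ ha => rw [map_smulₛₗ]; exact Submodule.smul_mem _ _ (ha trivial)

/-- Nakayama: lifts of generators of `X` generate `Y`. -/
lemma IsReduction.finite_of_finite {Y X : Type*} [AddCommGroup Y] [Module S Y] [AddCommGroup X]
    [Module R X] {π : Y →ₛₗ[D.proj] X} (hπ : D.IsReduction π) [Module.Finite R X] :
    Module.Finite S Y := by
  obtain ⟨c, v, hv⟩ := Module.Finite.exists_fin (R := R) (M := X)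
  refine Module.Finite.of_surjective
    (Finsupp.linearCombination S fun a => Function.surjInv hπ.1 (v a))
    (hπ.surjective_of_comp _ fun y => ?_)
  obtain ⟨f, hf⟩ : π y ∈ LinearMap.range (Finsupp.linearCombination R v) := by
    rw [Finsupp.range_linearCombination, hv]; trivial
  obtain ⟨g, rfl⟩ := (D.isReduction_freeMap _).1 f
  refine ⟨g, ?_⟩
  rw [map_linearCombination, ← hf]
  simp only [Function.surjInv_eq hπ.1]

/-- A bound for the projective dimension of a module from a bound for that of the reduction of
its first syzygy. -/
lemma hasProjectiveDimensionLE_succ_of_bound {Y : Type u} [AddCommGroup Y] [Module S Y] {n : ℕ}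
    {F : Type u} [AddCommGroup F] [Module S F] [Module.Projective S F] (hF : D.IsTorFree F)
    (p : F →ₗ[S] Y) (hp : Function.Surjective p)
    (h : ∀ (X : Type u) [AddCommGroup X] [Module R X] (π : LinearMap.ker p →ₛₗ[D.proj] X),
      D.IsReduction π → ((∃ l, HasProjectiveDimensionLE (ModuleCat.of S Y) l) →
        ∃ l, HasProjectiveDimensionLE (ModuleCat.of R X) l) →
        HasProjectiveDimensionLE (ModuleCat.of R X) n) :
    HasProjectiveDimensionLE (ModuleCat.of S Y) (n + 1) := by
  have hK := hF.of_injective _ (LinearMap.ker p).subtype_injective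
  obtain ⟨X, _, _, π, hπ⟩ := D.exists_isReduction (LinearMap.ker p)
  rw [hasProjectiveDimensionLE_succ_iff_ker p hp, hK.hasProjectiveDimensionLE_iff n hπ]
  refine h X π hπ fun ⟨l, hl⟩ => ⟨l, ?_⟩
  rw [← hK.hasProjectiveDimensionLE_iff l hπ, ← hasProjectiveDimensionLE_succ_iff_ker p hp]
  exact hasProjectiveDimensionLT_of_ge _ (l + 1) _ (by omega)

/-- Every module over the quotient is the reduction of a module without torsion. -/
def HasLifts : Prop :=
  ∀ (X : Type u) [AddCommGroup X] [Module R X], ∃ (Y : Type u) (_ : AddCommGroup Y)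
    (_ : Module S Y) (π : Y →ₛₗ[D.proj] X), D.IsTorFree Y ∧ D.IsReduction π

variable {D}

/-- A bound `n` over `S` is a bound over `R` by lifting; a bound `n` over `R` gives `n + 1` over `S`
through first syzygies. Noetherianness keeps these syzygies finitely generated. The two other
dimensions follow the same scheme without finiteness. -/
lemma littleFinitisticDim_lt_top_iff [IsNoetherianRing S] (hD : D.HasLifts) :
    littleFinitisticDim S < ⊤ ↔ littleFinitisticDim R < ⊤ := by
  rw [_root_.littleFinitisticDim_lt_top_iff, _root_.littleFinitisticDim_lt_top_iff]
  constructor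
  · rintro ⟨n, h⟩
    refine ⟨n, fun X hX ⟨l, hl⟩ => ?_⟩
    obtain ⟨Y, _, _, π, hY, hπ⟩ := hD X
    have := hπ.finite_of_finite
    exact (hY.hasProjectiveDimensionLE_iff n hπ).mp
      (h (ModuleCat.of S Y) this ⟨l, (hY.hasProjectiveDimensionLE_iff l hπ).mpr hl⟩)
  · rintro ⟨n, h⟩
    refine ⟨n + 1, fun Y hY ⟨l, hl⟩ => ?_⟩
    obtain ⟨c, v, hv⟩ := Module.Finite.exists_fin (R := S) (M := Y)
    refine D.hasProjectiveDimensionLE_succ_of_bound (Y := Y) (F := Fin c →₀ S)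
      (D.isTorFree_free _) (Finsupp.linearCombination S v)
      (LinearMap.range_eq_top.mp (by rw [Finsupp.range_linearCombination, hv])) ?_
    intro X _ _ π hπ hX
    exact h (ModuleCat.of R X) hπ.finite (hX ⟨l, hl⟩)

lemma bigFinitisticDim_lt_top_iff (hD : D.HasLifts) :
    bigFinitisticDim S < ⊤ ↔ bigFinitisticDim R < ⊤ := by
  rw [_root_.bigFinitisticDim_lt_top_iff, _root_.bigFinitisticDim_lt_top_iff]
  constructor
  · rintro ⟨n, h⟩
    refine ⟨n, fun X ⟨l, hl⟩ => ?_⟩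
    obtain ⟨Y, _, _, π, hY, hπ⟩ := hD X
    exact (hY.hasProjectiveDimensionLE_iff n hπ).mp
      (h (ModuleCat.of S Y) ⟨l, (hY.hasProjectiveDimensionLE_iff l hπ).mpr hl⟩)
  · rintro ⟨n, h⟩
    refine ⟨n + 1, fun Y ⟨l, hl⟩ => ?_⟩
    exact D.hasProjectiveDimensionLE_succ_of_bound (Y := Y) (D.isTorFree_free Y)
      (Finsupp.linearCombination S id) (Finsupp.linearCombination_id_surjective S Y)
      fun X _ _ π _ hX => h (ModuleCat.of R X) (hX ⟨l, hl⟩)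

lemma globalDim_lt_top_iff (hD : D.HasLifts) : globalDim S < ⊤ ↔ globalDim R < ⊤ := by
  rw [_root_.globalDim_lt_top_iff, _root_.globalDim_lt_top_iff]
  constructor
  · rintro ⟨n, h⟩
    refine ⟨n, fun X => ?_⟩
    obtain ⟨Y, _, _, π, hY, hπ⟩ := hD X
    exact (hY.hasProjectiveDimensionLE_iff n hπ).mp (h (ModuleCat.of S Y))
  · rintro ⟨n, h⟩
    refine ⟨n + 1, fun Y => ?_⟩
    exact D.hasProjectiveDimensionLE_succ_of_bound (Y := Y) (D.isTorFree_free Y)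
      (Finsupp.linearCombination S id) (Finsupp.linearCombination_id_surjective S Y)
      fun X _ _ π _ _ => h (ModuleCat.of R X)

/-- A split extension of rings, transported along an isomorphism. -/
def congr (D : SplitExtension S R β) {S' : Type u} [Ring S'] (θ : S' ≃+* S) :
    SplitExtension S' R β where
  proj := D.proj.comp (θ : S' →+* S)
  sec := (θ.symm : S →+* S').comp D.sec
  proj_sec r := by simp [D.proj_sec]
  idem := θ.symm D.idem
  idem_mul_idem := by rw [← map_mul, D.idem_mul_idem]
  gen b := θ.symm (D.gen b)
  gen_mul_idem b := by rw [← map_mul, D.gen_mul_idem]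
  proj_gen b := by simp [D.proj_gen]
  gen_mul_gen b c x := θ.injective (by simp [D.gen_mul_gen])
  exists_eq_sum x hx := by
    obtain ⟨z, hz⟩ := D.exists_eq_sum (θ x) hx
    exact ⟨fun b => θ.symm (z b), θ.injective (by simp [hz])⟩
  eq_zero z hz h b := by
    refine θ.injective ((D.eq_zero (fun b => θ (z b)) (fun b => ?_) ?_ b).trans (map_zero θ).symm)
    · conv_rhs => rw [← hz b]
      simp
    · rw [← map_zero θ, ← h]
      simp

lemma HasLifts.congr (hD : D.HasLifts) {S' : Type u} [Ring S'] (θ : S' ≃+* S) :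
    (D.congr θ).HasLifts := by
  intro X _ _
  obtain ⟨Y, _, _, π, hY, hπ⟩ := hD X
  let : Module S' Y := Module.compHom Y (θ : S' →+* S)
  have h : ∀ (s : S) (y : Y), θ.symm s • y = s • y := fun s y => by
    change θ (θ.symm s) • y = _
    rw [θ.apply_symm_apply]
  refine ⟨Y, inferInstance, inferInstance,
    { π with map_smul' := fun c y => π.map_smulₛₗ (θ c) y }, fun y hy hy' => ?_, hπ.1,
    fun y hy => ?_⟩
  · exact hY y (fun b => (h _ _).symm.trans (hy b))
      ((Finset.sum_congr rfl fun b _ => (h _ _).symm).trans hy')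
  · obtain ⟨z, hz⟩ := hπ.2 y hy
    exact ⟨z, hz.trans (Finset.sum_congr rfl fun b _ => (h _ _).symm)⟩

end ProjectiveDimension

end SplitExtension

/-! ## Trivial extensions by an outer tensor product -/

namespace OuterTensor

section

variable {k : Type w} [Field k] {W : Type u} {N : Type v} [AddCommGroup W] [Module k W]
  [AddCommGroup N] [Module k N] {β : Type*} [Fintype β] (B : Module.Basis β k W)

lemma tmul_zero (x : W) : tmul k x (0 : N) = 0 := TensorProduct.tmul_zero N x

lemma zero_tmul (y : N) : tmul k (0 : W) y = 0 := TensorProduct.zero_tmul W y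

lemma tmul_add (x : W) (y y' : N) : tmul k x (y + y') = tmul k x y + tmul k x y' :=
  TensorProduct.tmul_add x y y'

/-- With the next lemma: a basis of `W` splits `W ⊗ N` into copies of `N`, which supplies the
generators of the split extension. -/
lemma exists_eq_sum_basis (t : OuterTensor k W N) : ∃ n : β → N, t = ∑ b, tmul k (B b) (n b) := by
  obtain ⟨c, hc⟩ := TensorProduct.eq_repr_basis_left B t
  refine ⟨c, hc.symm.trans ?_⟩
  exact Finsupp.sum_fintype _ _ fun b => TensorProduct.tmul_zero _ _

lemma eq_zero_of_sum_basis (n : β → N) (h : ∑ b, tmul k (B b) (n b) = 0) (b : β) : n b = 0 := by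
  classical
  have := TensorProduct.sum_tmul_basis_left_eq_zero B (Finsupp.equivFunOnFinite.symm n) (by
    rw [Finsupp.sum_fintype _ _ fun b => TensorProduct.tmul_zero _ _]
    exact h)
  exact DFunLike.congr_fun this b

lemma smul_eq_zero_of_forall {A : Type*} [Ring A] [Algebra k A] [Module A W] [IsScalarTower k A W]
    {a : A} (ha : ∀ x : W, a • x = 0) (t : OuterTensor k W N) : a • t = 0 := by
  induction t using induction_on with
  | zero => simp
  | tmul x y => rw [smul_tmul, ha, zero_tmul]
  | add s t hs ht => rw [smul_add, hs, ht, add_zero]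

end

end OuterTensor

section

variable {R : Type u} [Ring R] {e : R}

lemma idem_mul_of_mem_rightPrincipal (he : e * e = e) {y : R} (hy : y ∈ rightPrincipal e) :
    e * y = y := by
  obtain ⟨r, rfl⟩ := Submodule.mem_span_singleton.mp hy
  rw [MulOpposite.smul_eq_mul_unop, ← mul_assoc, he]

lemma mul_mem_rightPrincipal (e r : R) : e * r ∈ rightPrincipal e :=
  Submodule.mem_span_singleton.mpr ⟨MulOpposite.op r, rfl⟩

/-- The generator of `e R`. -/
def rightGen (e : R) : rightPrincipal e := ⟨e, Submodule.mem_span_singleton_self e⟩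

end

namespace OuterTensor

/-! ### The pairing of `W ⊗ e R` with an `R`-module -/

section Lift

variable {k : Type w} [Field k] {R : Type u} [Ring R] [Algebra k R]
  {W : Type u} [AddCommGroup W] [Module k W] {e : R}

variable {X : Type u} [AddCommGroup X] [Module k X] [Module R X] [IsScalarTower k R X]

variable (k X) in
/-- The subspace `e X` of an `R`-module `X`, for an idempotent `e`. -/
def idemPart (e : R) : Submodule k X where
  carrier := {x | e • x = x}
  zero_mem' := smul_zero e
  add_mem' {x y} hx hy := (smul_add e x y).trans (congrArg₂ _ hx hy)
  smul_mem' c x hx := by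
    change e • c • x = c • x
    have : e • c • x = c • e • x := by
      rw [← algebraMap_smul R c x, ← algebraMap_smul R c (e • x), smul_smul, smul_smul,
        Algebra.commutes]
    rw [this, show e • x = x from hx]

/-- The map `e R → e X` given by an element of `X`. -/
def evalAt (he : e * e = e) (x : X) : rightPrincipal e →ₗ[k] idemPart k X e where
  toFun y := ⟨(y : R) • x, by
    change e • (y : R) • x = _
    rw [smul_smul, idem_mul_of_mem_rightPrincipal he y.2]⟩
  map_add' y z := Subtype.ext (add_smul _ _ _)
  map_smul' c y := Subtype.ext (smul_assoc c (y : R) x)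

/-- The action of an element of `W ⊗ e R` on an element of `X`. -/
noncomputable def act (he : e * e = e) (x : X) (t : OuterTensor k W (rightPrincipal e)) :
    OuterTensor k W (idemPart k X e) :=
  LinearMap.lTensor W (evalAt (k := k) he x) t

variable (he : e * e = e)

lemma act_tmul (x : X) (a : W) (y : rightPrincipal e) :
    act he x (tmul k a y) = tmul k a (evalAt he x y) := rfl

lemma act_add (x : X) (s t : OuterTensor k W (rightPrincipal e)) :
    act he x (s + t) = act he x s + act he x t :=
  map_add (LinearMap.lTensor W (evalAt (k := k) he x)) s t

lemma act_zero (x : X) : act he x (0 : OuterTensor k W (rightPrincipal e)) = 0 :=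
  map_zero (LinearMap.lTensor W (evalAt (k := k) he x))

lemma add_act (x x' : X) (t : OuterTensor k W (rightPrincipal e)) :
    act he (x + x') t = act he x t + act he x' t := by
  have : evalAt (k := k) he (x + x') = evalAt he x + evalAt he x' :=
    LinearMap.ext fun y => Subtype.ext (smul_add _ _ _)
  unfold act
  rw [this, LinearMap.lTensor_add]
  rfl

lemma zero_act (t : OuterTensor k W (rightPrincipal e)) : act he (0 : X) t = 0 := by
  have h := add_act he (0 : X) 0 t
  rw [add_zero] at h
  exact left_eq_add.mp h

/-- Balancedness over `R`: `act` thus represents the tensor product of `W ⊗ e R` with `X` over `R`,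
which is `W ⊗ e X`. Associativity of the induced module rests on it. -/
lemma act_op_smul (r : R) (x : X) (t : OuterTensor k W (rightPrincipal e)) :
    act he x (MulOpposite.op r • t) = act he (r • x) t := by
  induction t using induction_on with
  | zero => rw [smul_zero, act_zero, act_zero]
  | tmul a y =>
    rw [op_smul_tmul, act_tmul, act_tmul]
    congr 1
    exact Subtype.ext (mul_smul (y : R) r x)
  | add s t hs ht => rw [smul_add, act_add, hs, ht, act_add]

end Lift

/-! ### The trivial extension as a split extension, and induced modules -/

section

variable {k : Type w} [Field k] {R : Type u} [Ring R] [Algebra k R]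
  {W : Type u} [AddCommGroup W] [Module k W] [Module R W] [IsScalarTower k R W] {e : R}

/-- The trivial extension of `R` by `W ⊗ e R`. -/
abbrev TrivExt (k : Type w) [Field k] {R : Type u} [Ring R] [Algebra k R] (W : Type u)
    [AddCommGroup W] [Module k W] [Module R W] [IsScalarTower k R W] (e : R) : Type u :=
  TrivSqZeroExt R (OuterTensor k W (rightPrincipal e))

open TrivSqZeroExt

lemma inr_tmul_mul (x : W) (s : TrivExt k W e) :
    (inr (tmul k x (rightGen e)) : TrivExt k W e) * s =
      inr (tmul k x ⟨e * s.fst, mul_mem_rightPrincipal e _⟩) := by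
  ext
  · simp
  · rw [snd_mul, snd_inr, fst_inr, zero_smul, zero_add, op_smul_tmul]
    rfl

lemma inr_sum' {ι : Type*} (s : Finset ι) (f : ι → OuterTensor k W (rightPrincipal e)) :
    (inr (∑ i ∈ s, f i) : TrivExt k W e) = ∑ i ∈ s, inr (f i) :=
  map_sum (inrHom R (OuterTensor k W (rightPrincipal e))) f s

variable {β : Type m} [Fintype β]

variable (k) in
/-- The trivial extension of `R` by `W ⊗ e R`, where `e W = 0`, as a split extension. -/
noncomputable def splitExtension (he : e * e = e) (heW : ∀ x : W, e • x = 0)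
    (B : Module.Basis β k W) : SplitExtension (TrivExt k W e) R β where
  proj := (fstHom k R (OuterTensor k W (rightPrincipal e)) : _ →+* R)
  sec := inlHom R (OuterTensor k W (rightPrincipal e))
  proj_sec r := rfl
  idem := inl e
  idem_mul_idem := by rw [← inl_mul, he]
  gen b := inr (tmul k (B b) (rightGen e))
  gen_mul_idem b := by
    rw [inr_tmul_mul]
    congr 2
    exact Subtype.ext he
  proj_gen b := rfl
  gen_mul_gen b c x := by
    rw [inr_tmul_mul]
    have : (⟨e * (x * inr (tmul k (B c) (rightGen e)) : TrivExt k W e).fst,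
      mul_mem_rightPrincipal e _⟩ : rightPrincipal e) = 0 := Subtype.ext (by simp)
    rw [this, tmul_zero, inr_zero]
  exists_eq_sum x hx := by
    obtain ⟨n, hn⟩ := exists_eq_sum_basis B x.snd
    refine ⟨fun b => inl (n b : R), ?_⟩
    rw [← inl_fst_add_inr_snd_eq x, show x.fst = 0 from hx, inl_zero, zero_add, hn, inr_sum']
    refine Finset.sum_congr rfl fun b _ => ?_
    rw [inr_tmul_mul]
    congr 2
    exact Subtype.ext (idem_mul_of_mem_rightPrincipal he (n b).2).symm
  eq_zero z hz h b := by
    have h1 : ∀ b, e * (z b).fst = (z b).fst := fun b => congrArg fst (hz b)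
    -- Here `e W = 0` is decisive: it gives `e S = e R` for the trivial extension `S`, so a
    -- coefficient fixed by `inl e` has no bimodule component to be lost on multiplication by `gen
    -- b`.
    have h2 : ∀ b, (z b).snd = 0 := fun b => by
      have := congrArg snd (hz b)
      rw [snd_mul, snd_inl, smul_zero, add_zero, fst_inl, smul_eq_zero_of_forall heW] at this
      exact this.symm
    simp only [inr_tmul_mul] at h
    rw [← inr_sum', ← inr_zero, inr_injective.eq_iff] at h
    have h3 := eq_zero_of_sum_basis B _ h b
    refine TrivSqZeroExt.ext ?_ (h2 b)
    rw [← h1]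
    exact congrArg Subtype.val h3

section Lift

variable {X : Type u} [AddCommGroup X] [Module k X] [Module R X] [IsScalarTower k R X]
  (he : e * e = e)

lemma act_smul (r : R) (x : X) (t : OuterTensor k W (rightPrincipal e)) :
    act he x (r • t) = r • act he x t := by
  induction t using induction_on with
  | zero => rw [smul_zero, act_zero, smul_zero]
  | tmul a y => rfl
  | add s t hs ht => rw [smul_add, act_add, hs, ht, act_add, smul_add]

/-- The module over the trivial extension induced by `X`. -/
@[reducible]
noncomputable def inducedModule :
    Module (TrivExt k W e) (X × OuterTensor k W (idemPart k X e)) where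
  smul s y := (s.fst • y.1, s.fst • y.2 + act he y.1 s.snd)
  one_smul y := Prod.ext (one_smul R y.1)
    (by change (1 : R) • y.2 + act he y.1 0 = y.2; rw [one_smul, act_zero, add_zero])
  mul_smul s s' y := Prod.ext (mul_smul s.fst s'.fst y.1) (by
    change (s * s').fst • y.2 + act he y.1 (s * s').snd =
      s.fst • (s'.fst • y.2 + act he y.1 s'.snd) + act he (s'.fst • y.1) s.snd
    rw [fst_mul, snd_mul, act_add, act_smul, act_op_smul, mul_smul, smul_add, add_assoc])
  smul_zero s := Prod.ext (smul_zero s.fst) (by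
    change s.fst • (0 : OuterTensor k W (idemPart k X e)) + act he 0 s.snd = 0
    rw [smul_zero, zero_act, add_zero])
  smul_add s y y' := Prod.ext (smul_add s.fst y.1 y'.1) (by
    change s.fst • (y.2 + y'.2) + act he (y.1 + y'.1) s.snd =
      (s.fst • y.2 + act he y.1 s.snd) + (s.fst • y'.2 + act he y'.1 s.snd)
    rw [smul_add, add_act]
    abel)
  add_smul s s' y := Prod.ext (add_smul s.fst s'.fst y.1) (by
    change (s.fst + s'.fst) • y.2 + act he y.1 (s.snd + s'.snd) =
      (s.fst • y.2 + act he y.1 s.snd) + (s'.fst • y.2 + act he y.1 s'.snd)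
    rw [add_smul, act_add]
    abel)
  zero_smul y := Prod.ext (zero_smul R y.1) (by
    change (0 : R) • y.2 + act he y.1 0 = 0
    rw [zero_smul, act_zero, add_zero])

end Lift

/-- The lift of `X` is the induced module `X ⊕ (W ⊗ e X)` with its first projection. Since `e` kills
the second summand, a torsion relation amounts to a sum of terms `B b ⊗ e x_b` being zero, which
forces each `e x_b = x_b` to vanish. -/
lemma hasLifts_splitExtension (he : e * e = e) (heW : ∀ x : W, e • x = 0)
    (B : Module.Basis β k W) : (splitExtension k he heW B).HasLifts := by
  intro X _ _
  let : Module k X := Module.compHom X (algebraMap k R)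
  have : IsScalarTower k R X := ⟨fun c r x => by
    rw [Algebra.smul_def, mul_smul]; rfl⟩
  let : Module (TrivExt k W e) (X × OuterTensor k W (idemPart k X e)) := inducedModule he
  have hsmul : ∀ (s : TrivExt k W e) (y : X × OuterTensor k W (idemPart k X e)),
    s • y = (s.fst • y.1, s.fst • y.2 + act he y.1 s.snd) := fun _ _ => rfl
  have hgen : ∀ (a : W) (y : X × OuterTensor k W (idemPart k X e)),
      (inr (tmul k a (rightGen e)) : TrivExt k W e) • y =
        (0, tmul k a (evalAt he y.1 (rightGen e))) := fun a y => by
    rw [hsmul, fst_inr, zero_smul, zero_smul, zero_add]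
    rfl
  have hsum : ∀ y : β → X × OuterTensor k W (idemPart k X e),
      ∑ b, (inr (tmul k (B b) (rightGen e)) : TrivExt k W e) • y b =
        (0, ∑ b, tmul k (B b) (evalAt he (y b).1 (rightGen e))) := fun y => by
    simp only [hgen]
    refine Prod.ext ?_ ?_
    · rw [Prod.fst_sum]
      exact Finset.sum_const_zero
    · rw [Prod.snd_sum]
  refine ⟨X × OuterTensor k W (idemPart k X e), inferInstance, inferInstance,
    { toFun := Prod.fst, map_add' := fun _ _ => rfl, map_smul' := fun _ _ => rfl }, ?_,
    Prod.fst_surjective, ?_⟩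
  · intro y hy h b
    have hy' : ∀ b, (inl e : TrivExt k W e) • y b = y b := hy
    have h1 : ∀ b, e • (y b).1 = (y b).1 := fun b => congrArg Prod.fst (hy' b)
    have h2 : (y b).2 = 0 := by
      have := congrArg Prod.snd (hy' b)
      rw [hsmul, fst_inl, snd_inl, act_zero, add_zero, smul_eq_zero_of_forall heW] at this
      exact this.symm
    have h3 := congrArg Prod.snd ((hsum y).symm.trans h)
    refine Prod.ext ?_ h2
    rw [← h1]
    exact congrArg Subtype.val (eq_zero_of_sum_basis B _ h3 b)
  · rintro ⟨x, t⟩ (rfl : x = 0)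
    obtain ⟨n, rfl⟩ := exists_eq_sum_basis B t
    refine ⟨fun b => ((n b : X), 0), Eq.trans ?_ (hsum _).symm⟩
    refine Prod.ext rfl (Finset.sum_congr rfl fun b _ => ?_)
    congr 1
    exact Subtype.ext (n b).2.symm

end

end OuterTensor

/-! ## Algebra homomorphisms from path algebras and their quotients -/

namespace PathAlgebra

section Lift

variable {k : Type w} {Q : Type u} [CommRing k] [Quiver.{v} Q] {A : Type*} [Ring A]
  [Algebra k A]

lemma path_cons {a b c : Q} (p : Quiver.Path a b) (f : b ⟶ c) :
    path k (p.cons f) = path k p * path k f.toPath :=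
  (path_mul_path p f.toPath).symm

lemma triv_mul_triv (a : Q) : triv k a * triv k a = triv k a :=
  path_mul_path (k := k) (Quiver.Path.nil : Quiver.Path a a) Quiver.Path.nil

lemma triv_mul_triv_of_ne {a b : Q} (h : a ≠ b) : triv k a * triv k b = 0 :=
  path_mul_path_of_ne (k := k) _ _ h

lemma triv_mul_path {a b : Q} (p : Quiver.Path a b) : triv k a * path k p = path k p := by
  rw [triv, path_mul_path, Quiver.Path.nil_comp]

lemma path_mul_triv {a b : Q} (p : Quiver.Path a b) : path k p * triv k b = path k p :=
  path_mul_path (k := k) p Quiver.Path.nil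

/-- The product of the values of the arrows of a path. -/
def pathVal (E : Q → A) (φ : ∀ a b : Q, (a ⟶ b) → A) {a : Q} : ∀ {b : Q}, Quiver.Path a b → A
  | _, .nil => E a
  | _, .cons p f => pathVal E φ p * φ _ _ f

variable [Fintype Q]

lemma algHom_ext {F G : PathAlgebra k Q →ₐ[k] A} (h : ∀ a, F (triv k a) = G (triv k a))
    (h' : ∀ (a b : Q) (f : a ⟶ b), F (path k f.toPath) = G (path k f.toPath)) : F = G := by
  refine AlgHom.toLinearMap_injective (lin_ext fun a b p => ?_)
  change F (path k p) = G (path k p)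
  induction p with
  | nil => exact h a
  | cons p f ih => rw [path_cons, map_mul, map_mul, ih, h']

/-- Values at the vertices and the arrows of a quiver from which a homomorphism from the path
algebra can be built. -/
structure PathRep (Q : Type u) [Quiver.{v} Q] [Fintype Q] (A : Type*) [Ring A] where
  vertex : Q → A
  arrow : ∀ a b : Q, (a ⟶ b) → A
  sum_vertex : ∑ a, vertex a = 1
  vertex_mul_self : ∀ a, vertex a * vertex a = vertex a
  vertex_mul_of_ne : ∀ a b, a ≠ b → vertex a * vertex b = 0
  vertex_mul_arrow : ∀ a b f, vertex a * arrow a b f = arrow a b f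
  arrow_mul_vertex : ∀ a b f, arrow a b f * vertex b = arrow a b f

namespace PathRep

variable (r : PathRep Q A)

lemma pathVal_mul_vertex {a b : Q} (p : Quiver.Path a b) :
    pathVal r.vertex r.arrow p * r.vertex b = pathVal r.vertex r.arrow p := by
  cases p with
  | nil => exact r.vertex_mul_self a
  | cons p f => rw [pathVal, mul_assoc, r.arrow_mul_vertex]

lemma vertex_mul_pathVal {a b : Q} (p : Quiver.Path a b) :
    r.vertex a * pathVal r.vertex r.arrow p = pathVal r.vertex r.arrow p := by
  induction p with
  | nil => exact r.vertex_mul_self a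
  | cons p f ih => rw [pathVal, ← mul_assoc, ih]

lemma pathVal_comp {a b c : Q} (p : Quiver.Path a b) (q : Quiver.Path b c) :
    pathVal r.vertex r.arrow (p.comp q) =
      pathVal r.vertex r.arrow p * pathVal r.vertex r.arrow q := by
  induction q with
  | nil => exact (r.pathVal_mul_vertex p).symm
  | cons q f ih => rw [Quiver.Path.comp_cons, pathVal, pathVal, ih, mul_assoc]

lemma pathVal_mul_of_ne {a b c d : Q} (p : Quiver.Path a b) (q : Quiver.Path c d) (h : b ≠ c) :
    pathVal r.vertex r.arrow p * pathVal r.vertex r.arrow q = 0 := by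
  rw [← r.pathVal_mul_vertex p, ← r.vertex_mul_pathVal q, mul_assoc, ← mul_assoc (r.vertex b),
    r.vertex_mul_of_ne b c h, zero_mul, mul_zero]

variable (k) in
/-- The homomorphism with given values at the vertices and the arrows. -/
noncomputable def toAlgHom : PathAlgebra k Q →ₐ[k] A :=
  AlgHom.ofLinearMap (lift k fun p => pathVal r.vertex r.arrow p.2.2)
    (by rw [one_def, map_sum, ← r.sum_vertex]
        exact Finset.sum_congr rfl fun a _ => lift_path _ _)
    (by
      let L : PathAlgebra k Q →ₗ[k] A := lift k fun p => pathVal r.vertex r.arrow p.2.2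
      have h : (LinearMap.mul k (PathAlgebra k Q)).compr₂ L =
          (LinearMap.mul k A).compl₁₂ L L := by
        refine lin_ext fun a b p => lin_ext fun c d q => ?_
        change L (path k p * path k q) = L (path k p) * L (path k q)
        have hL : ∀ (a b : Q) (p : Quiver.Path a b),
          L (path k p) = pathVal r.vertex r.arrow p := fun _ _ p => lift_path _ p
        rw [hL, hL]
        by_cases h : b = c
        · subst h
          rw [path_mul_path, hL, r.pathVal_comp]
        · rw [path_mul_path_of_ne p q h, map_zero, r.pathVal_mul_of_ne p q h]
      exact fun x y => LinearMap.congr_fun (LinearMap.congr_fun h x) y)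

@[simp] lemma toAlgHom_triv (a : Q) : r.toAlgHom k (triv k a) = r.vertex a :=
  lift_path (k := k) _ (Quiver.Path.nil : Quiver.Path a a)

@[simp] lemma toAlgHom_arrow {a b : Q} (f : a ⟶ b) :
    r.toAlgHom k (path k f.toPath) = r.arrow a b f :=
  (lift_path (k := k) _ f.toPath).trans (r.vertex_mul_arrow a b f)

lemma toAlgHom_path {a b : Q} (p : Quiver.Path a b) :
    r.toAlgHom k (path k p) = pathVal r.vertex r.arrow p :=
  lift_path (k := k) _ p

end PathRep

end Lift

/-! ### Quotients of path algebras and their characters at the vertices -/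

section Quotient

variable {k : Type w} [Field k] {Q : Type u} [Quiver.{v} Q] [Fintype Q]
  (I : TwoSidedIdeal (PathAlgebra k Q))

/-- The projection to the quotient algebra as a homomorphism of algebras. -/
noncomputable def mkAlg : PathAlgebra k Q →ₐ[k] QuotAlgebra I := I.ringCon.mkₐ k

lemma mkAlg_apply (x : PathAlgebra k Q) : mkAlg I x = mk I x := rfl

lemma mk_surjective : Function.Surjective (mk I) := I.ringCon.mk'_surjective

lemma mk_mul (x y : PathAlgebra k Q) : mk I (x * y) = mk I x * mk I y := map_mul (mkAlg I) x y

lemma mk_eq_zero_iff (x : PathAlgebra k Q) : mk I x = 0 ↔ x ∈ I := by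
  rw [TwoSidedIdeal.mem_iff]
  exact I.ringCon.eq

variable {A : Type*} [Ring A] [Algebra k A]

/-- The homomorphism from the quotient algebra induced by a homomorphism that kills the ideal. -/
noncomputable def quotLift (F : PathAlgebra k Q →ₐ[k] A) (hF : ∀ x ∈ I, F x = 0) :
    QuotAlgebra I →ₐ[k] A :=
  I.ringCon.liftₐ F fun x y h => by
    have h' := hF _ ((I.rel_iff x y).mp h)
    rw [map_sub, sub_eq_zero] at h'
    exact h'

@[simp] lemma quotLift_mk (F : PathAlgebra k Q →ₐ[k] A) (hF : ∀ x ∈ I, F x = 0)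
    (x : PathAlgebra k Q) : quotLift I F hF (mk I x) = F x := rfl

lemma vertexIdem_mul_self (a : Q) : vertexIdem I a * vertexIdem I a = vertexIdem I a := by
  rw [vertexIdem, ← mk_mul, triv_mul_triv]

lemma vertexIdem_mul_of_ne {a b : Q} (h : a ≠ b) : vertexIdem I a * vertexIdem I b = 0 := by
  rw [vertexIdem, vertexIdem, ← mk_mul, triv_mul_triv_of_ne h]
  exact map_zero (mkAlg I)

lemma vertexIdem_mul_mk_path {a b : Q} (p : Quiver.Path a b) :
    vertexIdem I a * mk I (path k p) = mk I (path k p) := by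
  rw [vertexIdem, ← mk_mul, triv_mul_path]

lemma mk_path_mul_vertexIdem {a b : Q} (p : Quiver.Path a b) :
    mk I (path k p) * vertexIdem I b = mk I (path k p) := by
  rw [vertexIdem, ← mk_mul, path_mul_triv]

lemma sum_vertexIdem : ∑ a, vertexIdem I a = 1 := by
  rw [← map_one (mkAlg I), one_def, map_sum]
  rfl

variable (k) in
open Classical in
/-- The simple representation at a vertex. -/
noncomputable def simpleRep (a : Q) : PathRep Q k where
  vertex b := if b = a then 1 else 0
  arrow _ _ _ := 0
  sum_vertex := by simp
  vertex_mul_self b := by split_ifs <;> simp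
  vertex_mul_of_ne b c h := by
    by_cases hb : b = a
    · subst hb; simp [Ne.symm h]
    · simp [hb]
  vertex_mul_arrow _ _ _ := mul_zero _
  arrow_mul_vertex _ _ _ := zero_mul _

lemma simpleRep_toAlgHom_apply (a : Q) (x : PathAlgebra k Q) :
    (simpleRep k a).toAlgHom k x = coeff x ⟨a, a, Quiver.Path.nil⟩ := by
  classical
  let c : PathAlgebra k Q →ₗ[k] k :=
    Finsupp.lapply (R := k) (⟨a, a, Quiver.Path.nil⟩ : AllPaths Q)
  have : ((simpleRep k a).toAlgHom k).toLinearMap = c := by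
    refine lin_ext fun b d p => ?_
    change (simpleRep k a).toAlgHom k (path k p) =
      Finsupp.single (⟨b, d, p⟩ : AllPaths Q) (1 : k) ⟨a, a, Quiver.Path.nil⟩
    rw [PathRep.toAlgHom_path]
    cases p with
    | nil =>
      change (if b = a then 1 else 0) = _
      by_cases h : b = a
      · subst h; simp
      · rw [if_neg h, Finsupp.single_eq_of_ne]
        exact fun h' => h (congrArg Sigma.fst h').symm
    | cons p f =>
      rw [Finsupp.single_eq_of_ne]
      · exact mul_zero _
      · exact fun h' => absurd (congrArg (fun q : AllPaths Q => q.2.2.length) h') (by simp)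
  exact LinearMap.congr_fun this x

variable {I} (hI : IsAdmissible I)

/-- The coefficient of the trivial path at a vertex, as a character of a bound quiver algebra. -/
noncomputable def vertexChar (hI : IsAdmissible I) (a : Q) : QuotAlgebra I →ₐ[k] k :=
  quotLift I ((simpleRep k a).toAlgHom k) fun x hx => by
    rw [simpleRep_toAlgHom_apply]
    -- Paths occurring in elements of `I` have length at least two, so a trivial path cannot occur.
    by_contra h
    have := hI.1 x hx _ h
    simp at this

lemma vertexChar_vertexIdem (a : Q) : vertexChar hI a (vertexIdem I a) = 1 :=
  ((simpleRep k a).toAlgHom_triv a).trans (if_pos rfl)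

lemma vertexChar_vertexIdem_of_ne {a b : Q} (h : b ≠ a) : vertexChar hI a (vertexIdem I b) = 0 :=
  ((simpleRep k a).toAlgHom_triv b).trans (if_neg h)

lemma vertexIdem_ne_zero (hI : IsAdmissible I) (a : Q) : vertexIdem I a ≠ 0 := fun h => by
  have := vertexChar_vertexIdem hI a
  rw [h, map_zero] at this
  exact zero_ne_one this

end Quotient

/-! ### Finite dimensionality of bound quiver algebras -/

section Finite

variable {k : Type w} [Field k] {Q : Type u} [Quiver.{v} Q] [Fintype Q]
  {I : TwoSidedIdeal (PathAlgebra k Q)}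

lemma finite_setOf_length_eq [∀ a b : Q, Finite (a ⟶ b)] (n : ℕ) :
    {p : AllPaths Q | p.2.2.length = n}.Finite := by
  induction n with
  | zero =>
    refine (Set.finite_range fun a : Q => (⟨a, a, .nil⟩ : AllPaths Q)).subset ?_
    rintro ⟨a, b, p⟩ hp
    cases p with
    | nil => exact ⟨a, rfl⟩
    | cons p f => simp at hp
  | succ n ih =>
    refine (ih.biUnion fun p _ => Set.finite_iUnion fun c : Q => Set.finite_range
      fun f : p.2.1 ⟶ c => (⟨p.1, c, p.2.2.cons f⟩ : AllPaths Q)).subset ?_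
    rintro ⟨a, b, p⟩ hp
    cases p with
    | nil => simp at hp
    | @cons c _ p f =>
      refine Set.mem_biUnion (x := ⟨a, c, p⟩) ?_ (Set.mem_iUnion.mpr ⟨b, f, rfl⟩)
      simpa using hp

lemma path_mem_of_le_length {N : ℕ}
    (hN : ∀ (a b : Q) (p : Quiver.Path a b), p.length = N → path k p ∈ I) {a b : Q}
    (p : Quiver.Path a b) (hp : N ≤ p.length) : path k p ∈ I := by
  induction p with
  | nil => exact hN _ _ _ (by simp at hp ⊢; exact hp.symm)
  | cons p f ih =>
    rcases hp.eq_or_lt with h | h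
    · exact hN _ _ _ h.symm
    · rw [path_cons]
      exact I.mul_mem_right _ _ (ih (by simpa [Nat.lt_succ_iff] using h))

/-- The finitely many paths of length less than `N` span, because all longer paths lie in `I`. -/
lemma finite_quotAlgebra [∀ a b : Q, Finite (a ⟶ b)] (hI : IsAdmissible I) :
    Module.Finite k (QuotAlgebra I) := by
  obtain ⟨N, -, hN⟩ := hI.2
  have hfin : {p : AllPaths Q | p.2.2.length < N}.Finite := by
    refine ((Set.finite_lt_nat N).biUnion fun n _ => finite_setOf_length_eq (Q := Q) n).subset ?_
    exact fun p hp => Set.mem_biUnion (show p.2.2.length ∈ {i | i < N} from hp) rfl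
  refine ⟨Submodule.fg_def.mpr ⟨_, hfin.image fun p => mk I (path k p.2.2), ?_⟩⟩
  refine eq_top_iff.mpr fun x _ => ?_
  obtain ⟨x, rfl⟩ := mk_surjective I x
  set U := Submodule.span k ((fun p : AllPaths Q => mk I (path k p.2.2)) ''
    {p : AllPaths Q | p.2.2.length < N})
  have h : U.mkQ ∘ₗ (mkAlg I).toLinearMap = 0 := by
    refine lin_ext fun a b p => ?_
    change U.mkQ (mk I (path k p)) = 0
    by_cases hp : p.length < N
    · exact (Submodule.Quotient.mk_eq_zero U).mpr (Submodule.subset_span ⟨⟨a, b, p⟩, hp, rfl⟩)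
    · rw [(mk_eq_zero_iff I _).mpr (path_mem_of_le_length hN p (not_lt.mp hp)), map_zero]
  exact (Submodule.Quotient.mk_eq_zero U).mp (LinearMap.congr_fun h x)

end Finite

end PathAlgebra

/-! ## Trivial one-arrow extensions as trivial extensions -/

section

variable {R : Type u} [Ring R] {e : R}

/-- The generator of `R e`. -/
def leftGen (e : R) : leftPrincipal e := ⟨e, Submodule.mem_span_singleton_self e⟩

lemma mul_idem_of_mem_leftPrincipal (he : e * e = e) {x : R} (hx : x ∈ leftPrincipal e) :
    x * e = x := by
  obtain ⟨r, rfl⟩ := Submodule.mem_span_singleton.mp hx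
  rw [smul_eq_mul, mul_assoc, he]

lemma coe_smul_leftGen (he : e * e = e) (x : leftPrincipal e) : (x : R) • leftGen e = x :=
  Subtype.ext (mul_idem_of_mem_leftPrincipal he x.2)

lemma coe_smul_mkQ_leftGen (he : e * e = e) (V : Submodule R (leftPrincipal e))
    (x : leftPrincipal e) : (x : R) • V.mkQ (leftGen e) = V.mkQ x := by
  rw [← map_smul, coe_smul_leftGen he]

end

namespace AddArrow

open PathAlgebra OuterTensor TrivSqZeroExt

variable {k : Type w} [Field k] {Q : Type u} [Quiver.{v} Q]

section Incl

variable (i j : Q)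

lemma triv_mul_newArrowAlg :
    triv k ((incl i j).obj i) * newArrowAlg i j k = newArrowAlg i j k :=
  triv_mul_path _

lemma newArrowAlg_mul_triv :
    newArrowAlg i j k * triv k ((incl i j).obj j) = newArrowAlg i j k :=
  path_mul_triv _

lemma path_toPath_inr {i j a b : Q} (h : PLift (a = i ∧ b = j)) :
    path k (Quiver.Hom.toPath (V := AddArrow Q i j) (a := a) (b := b) (Sum.inr h)) =
      newArrowAlg i j k := by
  obtain ⟨rfl, rfl⟩ := h
  rfl

variable [Fintype Q]

variable (k) in
/-- The representation of `Q` in the path algebra of the larger quiver. -/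
noncomputable def inclRep : PathRep Q (PathAlgebra k (AddArrow Q i j)) where
  vertex a := triv k ((incl i j).obj a)
  arrow _ _ f := path k ((incl i j).map f).toPath
  sum_vertex := rfl
  vertex_mul_self _ := triv_mul_triv _
  vertex_mul_of_ne _ _ h := triv_mul_triv_of_ne (Q := AddArrow Q i j) h
  vertex_mul_arrow _ _ _ := triv_mul_path _
  arrow_mul_vertex _ _ _ := path_mul_triv _

lemma inclRep_toAlgHom_apply (x : PathAlgebra k Q) :
    (inclRep k i j).toAlgHom k x = inclAlg i j k x := by
  have : ((inclRep k i j).toAlgHom k).toLinearMap = inclAlg i j k := by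
    refine lin_ext fun a b p => ?_
    refine ((inclRep k i j).toAlgHom_path p).trans (Eq.trans ?_ (lift_path _ p).symm)
    induction p with
    | nil => rfl
    | cons p f ih =>
      rw [pathVal, ih]
      exact (path_cons _ _).symm
  exact LinearMap.congr_fun this x

end Incl

variable [Fintype Q] {I : TwoSidedIdeal (PathAlgebra k Q)} {i j : Q}
  (V : Submodule (QuotAlgebra I) (leftPrincipal (vertexIdem I i)))

lemma incl_mem_oneArrowIdeal {x : PathAlgebra k Q} (hx : x ∈ I) :
    inclAlg i j k x ∈ oneArrowIdeal I i j V :=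
  TwoSidedIdeal.subset_span (Or.inl ⟨x, hx, rfl⟩)

lemma incl_mul_newArrow_mem_oneArrowIdeal {z : PathAlgebra k Q} (hz : z * triv k i = z)
    (hzV : ∃ x ∈ V, (x : QuotAlgebra I) = mk I z) :
    inclAlg i j k z * newArrowAlg i j k ∈ oneArrowIdeal I i j V :=
  TwoSidedIdeal.subset_span (Or.inr ⟨z, hz, hzV, rfl⟩)

/-! ### The map to the trivial extension -/

section ToTrivExt

variable (j) in
/-- The element of the bimodule to which the new arrow corresponds. -/
noncomputable def arrowElem : oneArrowBimodule I i j V :=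
  tmul k (V.mkQ (leftGen (vertexIdem I i))) (rightGen (vertexIdem I j))

lemma vertexIdem_smul_arrowElem : vertexIdem I i • arrowElem j V = arrowElem j V := by
  rw [arrowElem, smul_tmul, ← map_smul]
  congr 2
  exact Subtype.ext (vertexIdem_mul_self I i)

lemma op_vertexIdem_smul_arrowElem :
    MulOpposite.op (vertexIdem I j) • arrowElem j V = arrowElem j V := by
  rw [arrowElem, op_smul_tmul]
  congr 1
  exact Subtype.ext (vertexIdem_mul_self I j)

variable (j) in
/-- The representation of the larger quiver in the trivial extension. -/
noncomputable def trivExtRep : PathRep (AddArrow Q i j)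
    (TrivSqZeroExt (QuotAlgebra I) (oneArrowBimodule I i j V)) where
  vertex a := inl (vertexIdem I (show Q from a))
  arrow a b f := Sum.elim
    (fun g : (show Q from a) ⟶ (show Q from b) => inl (mk I (path k g.toPath)))
    (fun _ => inr (arrowElem j V)) f
  sum_vertex := by
    have h := congrArg (inlAlgHom k (QuotAlgebra I) (oneArrowBimodule I i j V)) (sum_vertexIdem I)
    rw [map_sum, map_one] at h
    exact h
  vertex_mul_self a := by rw [← inl_mul, vertexIdem_mul_self]
  vertex_mul_of_ne a b h := by
    rw [← inl_mul, vertexIdem_mul_of_ne I (Q := Q) h, inl_zero]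
  vertex_mul_arrow a b f := by
    rcases f with f | ⟨ha, hb⟩
    · change inl _ * inl _ = inl _
      exact (inl_mul _ _ _).symm.trans (congrArg inl (vertexIdem_mul_mk_path I (Quiver.Hom.toPath (V := Q) f)))
    · change inl _ * inr _ = inr _
      rw [inl_mul_inr]
      exact congrArg inr ((congrArg (fun c : Q => vertexIdem I c • arrowElem j V) ha).trans
        (vertexIdem_smul_arrowElem V))
  arrow_mul_vertex a b f := by
    rcases f with f | ⟨ha, hb⟩
    · change inl _ * inl _ = inl _
      exact (inl_mul _ _ _).symm.trans (congrArg inl (mk_path_mul_vertexIdem I (Quiver.Hom.toPath (V := Q) f)))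
    · change inr _ * inl _ = inr _
      rw [inr_mul_inl]
      exact congrArg inr ((congrArg (fun c : Q => MulOpposite.op (vertexIdem I c) • arrowElem j V)
        hb).trans (op_vertexIdem_smul_arrowElem V))

lemma trivExtRep_incl (x : PathAlgebra k Q) :
    (trivExtRep j V).toAlgHom k (inclAlg i j k x) = inl (mk I x) := by
  have : ((trivExtRep j V).toAlgHom k).comp ((inclRep k i j).toAlgHom k) =
      (inlAlgHom k (QuotAlgebra I) (oneArrowBimodule I i j V)).comp (mkAlg I) := by
    refine algHom_ext (fun a => ?_) fun a b f => ?_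
    · rw [AlgHom.comp_apply, PathRep.toAlgHom_triv]
      exact PathRep.toAlgHom_triv _ _
    · rw [AlgHom.comp_apply, PathRep.toAlgHom_arrow]
      exact PathRep.toAlgHom_arrow _ _
  rw [← inclRep_toAlgHom_apply]
  exact DFunLike.congr_fun this x

lemma trivExtRep_newArrow :
    (trivExtRep j V).toAlgHom k (newArrowAlg i j k) = inr (arrowElem j V) :=
  PathRep.toAlgHom_arrow _ _

/-- The relation `z α` goes to the class of `z` in `Γ e_i / V` tensored with `e_j`, which is zero
for `z` in `V`. -/
lemma trivExtRep_eq_zero {y : PathAlgebra k (AddArrow Q i j)} (hy : y ∈ oneArrowIdeal I i j V) :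
    (trivExtRep j V).toAlgHom k y = 0 := by
  have h : oneArrowIdeal I i j V ≤ TwoSidedIdeal.ker ((trivExtRep j V).toAlgHom k) := by
    refine TwoSidedIdeal.span_le.mpr ?_
    rintro _ (⟨z, hz, rfl⟩ | ⟨z, hz, ⟨x, hx, hxz⟩, rfl⟩)
    · refine (TwoSidedIdeal.mem_ker _).mpr ?_
      rw [trivExtRep_incl, (mk_eq_zero_iff I z).mpr hz, inl_zero]
    · refine (TwoSidedIdeal.mem_ker _).mpr ?_
      rw [map_mul, trivExtRep_incl, trivExtRep_newArrow, inl_mul_inr, arrowElem, smul_tmul, ← hxz,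
        coe_smul_mkQ_leftGen (vertexIdem_mul_self I i), Submodule.mkQ_apply,
        (Submodule.Quotient.mk_eq_zero V).mpr hx, zero_tmul, inr_zero]
  exact (TwoSidedIdeal.mem_ker _).mp (h hy)

variable (j) in
/-- The homomorphism from the one-arrow extension to the trivial extension. -/
noncomputable def toTrivExt : QuotAlgebra (oneArrowIdeal I i j V) →ₐ[k]
    TrivSqZeroExt (QuotAlgebra I) (oneArrowBimodule I i j V) :=
  quotLift _ ((trivExtRep j V).toAlgHom k) fun _ => trivExtRep_eq_zero V

end ToTrivExt

/-! ### The map from the trivial extension -/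

section OfTrivExt

variable (j) in
/-- The map from the original algebra to its one-arrow extension. -/
noncomputable def ofBase : QuotAlgebra I →ₐ[k] QuotAlgebra (oneArrowIdeal I i j V) :=
  quotLift I ((mkAlg (oneArrowIdeal I i j V)).comp ((inclRep k i j).toAlgHom k)) fun x hx => by
    rw [AlgHom.comp_apply, inclRep_toAlgHom_apply, mkAlg_apply, mk_eq_zero_iff]
    exact incl_mem_oneArrowIdeal V hx

lemma ofBase_mk (x : PathAlgebra k Q) :
    ofBase j V (mk I x) = mk (oneArrowIdeal I i j V) (inclAlg i j k x) := by
  rw [← inclRep_toAlgHom_apply]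
  rfl

variable (j) in
/-- The class of the new arrow. -/
noncomputable def arrowClass : QuotAlgebra (oneArrowIdeal I i j V) :=
  mk (oneArrowIdeal I i j V) (newArrowAlg i j k)

lemma ofBase_mul_arrowClass_eq_zero {x : leftPrincipal (vertexIdem I i)} (hx : x ∈ V) :
    ofBase j V (x : QuotAlgebra I) * arrowClass j V = 0 := by
  obtain ⟨z, hz⟩ := mk_surjective I (x : QuotAlgebra I)
  -- The generators `z α` of the ideal require `z` in `kQ e_i`, so the representative is replaced by
  -- `z e_i`.
  have hz' : (x : QuotAlgebra I) = mk I (z * triv k i) := by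
    rw [mk_mul, hz]
    exact (mul_idem_of_mem_leftPrincipal (vertexIdem_mul_self I i) x.2).symm
  rw [hz', ofBase_mk, arrowClass, ← mk_mul, mk_eq_zero_iff]
  exact incl_mul_newArrow_mem_oneArrowIdeal V (by rw [mul_assoc, triv_mul_triv]) ⟨x, hx, hz'⟩

variable (j) in
/-- Multiplication with the class of the new arrow on the quotient by `V`. -/
noncomputable def mulArrow :
    (leftPrincipal (vertexIdem I i) ⧸ V) →ₗ[k] QuotAlgebra (oneArrowIdeal I i j V) :=
  (V.restrictScalars k).liftQ
    (LinearMap.mulRight k (arrowClass j V) ∘ₗ (ofBase j V).toLinearMap ∘ₗ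
      ((leftPrincipal (vertexIdem I i)).subtype.restrictScalars k))
    (fun _ hx => ofBase_mul_arrowClass_eq_zero V hx) ∘ₗ
  (Submodule.Quotient.restrictScalarsEquiv k V).symm.toLinearMap

variable (j) in
/-- The map from the bimodule to the one-arrow extension. -/
noncomputable def ofBimodule :
    oneArrowBimodule I i j V →ₗ[k] QuotAlgebra (oneArrowIdeal I i j V) :=
  TensorProduct.lift ((LinearMap.mul k _).compl₁₂ (mulArrow j V)
    ((ofBase j V).toLinearMap ∘ₗ
      ((rightPrincipal (vertexIdem I j)).subtype.restrictScalars k)))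

lemma ofBimodule_tmul (x : leftPrincipal (vertexIdem I i)) (y : rightPrincipal (vertexIdem I j)) :
    ofBimodule j V (tmul k (V.mkQ x) y) =
      ofBase j V (x : QuotAlgebra I) * arrowClass j V * ofBase j V (y : QuotAlgebra I) := rfl

lemma ofBimodule_arrowElem : ofBimodule j V (arrowElem j V) = arrowClass j V := by
  have h : ∀ a : Q, ofBase j V (vertexIdem I a) =
      mk (oneArrowIdeal I i j V) (triv k ((incl i j).obj a)) := fun a => by
    rw [vertexIdem, ofBase_mk]
    exact congrArg _ (lift_path _ _)
  rw [arrowElem, ofBimodule_tmul]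
  change ofBase j V (vertexIdem I i) * arrowClass j V * ofBase j V (vertexIdem I j) = _
  rw [h, h, arrowClass, ← mk_mul, ← mk_mul, triv_mul_newArrowAlg, newArrowAlg_mul_triv]

lemma ofBimodule_smul (r : QuotAlgebra I) (t : oneArrowBimodule I i j V) :
    ofBimodule j V (r • t) = ofBase j V r * ofBimodule j V t := by
  induction t using OuterTensor.induction_on with
  | zero => rw [smul_zero, map_zero, mul_zero]
  | tmul x y =>
    obtain ⟨x, rfl⟩ := V.mkQ_surjective x
    rw [smul_tmul, ← map_smul, ofBimodule_tmul, ofBimodule_tmul, ← mul_assoc, ← mul_assoc,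
      ← map_mul]
    rfl
  | add s t hs ht => rw [smul_add, map_add, hs, ht, map_add, mul_add]

lemma ofBimodule_op_smul (r : QuotAlgebra I) (t : oneArrowBimodule I i j V) :
    ofBimodule j V (MulOpposite.op r • t) = ofBimodule j V t * ofBase j V r := by
  induction t using OuterTensor.induction_on with
  | zero => rw [smul_zero, map_zero, zero_mul]
  | tmul x y =>
    obtain ⟨x, rfl⟩ := V.mkQ_surjective x
    rw [op_smul_tmul, ofBimodule_tmul, ofBimodule_tmul, mul_assoc _ _ (ofBase j V r), ← map_mul]
    rfl
  | add s t hs ht => rw [smul_add, map_add, hs, ht, map_add, add_mul]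

variable {V}

lemma coe_smul_mem (hV : ∀ x : leftPrincipal (vertexIdem I i),
      (∃ y, (x : QuotAlgebra I) = vertexIdem I j * y * vertexIdem I i) → x ∈ V)
    (y : rightPrincipal (vertexIdem I j)) (x : leftPrincipal (vertexIdem I i)) :
    (y : QuotAlgebra I) • x ∈ V := by
  refine hV _ ⟨y * x, ?_⟩
  rw [← mul_assoc, idem_mul_of_mem_rightPrincipal (vertexIdem_mul_self I j) y.2, mul_assoc,
    mul_idem_of_mem_leftPrincipal (vertexIdem_mul_self I i) x.2]
  rfl

/-- In `x α y · x' α y'` the middle factor `y x'` lies in `e_j Γ e_i ⊆ V`, so `(y x') α = 0`. -/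
lemma ofBimodule_mul_ofBimodule (hV : ∀ x : leftPrincipal (vertexIdem I i),
      (∃ y, (x : QuotAlgebra I) = vertexIdem I j * y * vertexIdem I i) → x ∈ V)
    (s t : oneArrowBimodule I i j V) : ofBimodule j V s * ofBimodule j V t = 0 := by
  induction s using OuterTensor.induction_on with
  | zero => rw [map_zero, zero_mul]
  | add s s' hs hs' => rw [map_add, add_mul, hs, hs', add_zero]
  | tmul x y =>
    induction t using OuterTensor.induction_on with
    | zero => rw [map_zero, mul_zero]
    | add t t' ht ht' => rw [map_add, mul_add, ht, ht', add_zero]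
    | tmul x' y' =>
      obtain ⟨x, rfl⟩ := V.mkQ_surjective x
      obtain ⟨x', rfl⟩ := V.mkQ_surjective x'
      have h := ofBase_mul_arrowClass_eq_zero (j := j) V (coe_smul_mem hV y x')
      rw [Submodule.coe_smul, smul_eq_mul, map_mul] at h
      rw [ofBimodule_tmul, ofBimodule_tmul, mul_assoc _ (ofBase j V (y : QuotAlgebra I)),
        ← mul_assoc (ofBase j V (y : QuotAlgebra I)), ← mul_assoc (ofBase j V (y : QuotAlgebra I)),
        h, zero_mul, mul_zero]

/-- The homomorphism from the trivial extension to the one-arrow extension. -/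
noncomputable def ofTrivExt (hV : ∀ x : leftPrincipal (vertexIdem I i),
      (∃ y, (x : QuotAlgebra I) = vertexIdem I j * y * vertexIdem I i) → x ∈ V) :
    TrivSqZeroExt (QuotAlgebra I) (oneArrowBimodule I i j V) →ₐ[k]
      QuotAlgebra (oneArrowIdeal I i j V) :=
  TrivSqZeroExt.lift (ofBase j V) (ofBimodule j V) (ofBimodule_mul_ofBimodule hV)
    (ofBimodule_smul V) (ofBimodule_op_smul V)

lemma ofTrivExt_inl (hV : ∀ x : leftPrincipal (vertexIdem I i),
      (∃ y, (x : QuotAlgebra I) = vertexIdem I j * y * vertexIdem I i) → x ∈ V)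
    (x : QuotAlgebra I) : ofTrivExt hV (inl x) = ofBase j V x :=
  TrivSqZeroExt.lift_apply_inl ..

lemma ofTrivExt_inr (hV : ∀ x : leftPrincipal (vertexIdem I i),
      (∃ y, (x : QuotAlgebra I) = vertexIdem I j * y * vertexIdem I i) → x ∈ V)
    (t : oneArrowBimodule I i j V) : ofTrivExt hV (inr t) = ofBimodule j V t :=
  TrivSqZeroExt.lift_apply_inr ..

/-- The one-arrow extension is a trivial extension. -/
noncomputable def equivTrivExt (hV : ∀ x : leftPrincipal (vertexIdem I i),
      (∃ y, (x : QuotAlgebra I) = vertexIdem I j * y * vertexIdem I i) → x ∈ V) :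
    QuotAlgebra (oneArrowIdeal I i j V) ≃ₐ[k]
      TrivSqZeroExt (QuotAlgebra I) (oneArrowBimodule I i j V) :=
  AlgEquiv.ofAlgHom (toTrivExt j V) (ofTrivExt hV)
    (by
      have hbase : ∀ x, toTrivExt j V (ofBase j V x) = inl x := fun x => by
        obtain ⟨x, rfl⟩ := mk_surjective I x
        rw [ofBase_mk, toTrivExt, quotLift_mk, trivExtRep_incl]
      refine TrivSqZeroExt.algHom_ext' (AlgHom.ext fun x => ?_) (LinearMap.ext fun t => ?_)
      · change toTrivExt j V (ofTrivExt hV (inl x)) = inl x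
        rw [ofTrivExt_inl, hbase]
      · change toTrivExt j V (ofTrivExt hV (inr t)) = inr t
        rw [ofTrivExt_inr]
        induction t using OuterTensor.induction_on with
        | zero => rw [map_zero, map_zero, inr_zero]
        | add s t hs ht => rw [map_add, map_add, hs, ht, inr_add]
        | tmul x y =>
          obtain ⟨x, rfl⟩ := V.mkQ_surjective x
          rw [ofBimodule_tmul, map_mul, map_mul, hbase, hbase, arrowClass, toTrivExt, quotLift_mk,
            trivExtRep_newArrow, inl_mul_inr, inr_mul_inl, arrowElem, smul_tmul,
            coe_smul_mkQ_leftGen (vertexIdem_mul_self I i), op_smul_tmul]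
          congr 2
          exact Subtype.ext (idem_mul_of_mem_rightPrincipal (vertexIdem_mul_self I j) y.2))
    (by
      have h : ((ofTrivExt hV).comp (toTrivExt j V)).comp (mkAlg (oneArrowIdeal I i j V)) =
          mkAlg (oneArrowIdeal I i j V) := by
        refine algHom_ext (fun a => ?_) fun a b f => ?_
        · change ofTrivExt hV ((trivExtRep j V).toAlgHom k (triv k a)) = _
          rw [PathRep.toAlgHom_triv]
          change ofTrivExt hV (inl (mk I (triv k (Q := Q) a))) = _
          rw [ofTrivExt_inl, ofBase_mk]
          exact congrArg _ (lift_path _ _)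
        · change ofTrivExt hV ((trivExtRep j V).toAlgHom k (path k f.toPath)) = _
          rcases f with f | f
          · rw [PathRep.toAlgHom_arrow]
            change ofTrivExt hV (inl (mk I (path k (Quiver.Hom.toPath (V := Q) f)))) = _
            rw [ofTrivExt_inl, ofBase_mk]
            exact congrArg _ (lift_path _ _)
          · rw [PathRep.toAlgHom_arrow]
            change ofTrivExt hV (inr (arrowElem j V)) = mk _ _
            rw [ofTrivExt_inr, ofBimodule_arrowElem]
            exact congrArg _ (path_toPath_inr (Q := Q) f).symm
      refine AlgHom.ext fun x => ?_
      obtain ⟨x, rfl⟩ := mk_surjective _ x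
      exact DFunLike.congr_fun h x)

end OfTrivExt

end AddArrow

/-! ## Strongly finite right projective dimension -/

lemma projective_rightPrincipal {R : Type u} [Ring R] {e : R} (he : e * e = e) :
    Module.Projective Rᵐᵒᵖ (rightPrincipal e) := by
  let s : rightPrincipal e →ₗ[Rᵐᵒᵖ] Rᵐᵒᵖ :=
    { toFun := fun y => MulOpposite.op (y : R), map_add' := fun _ _ => rfl,
      map_smul' := fun _ _ => rfl }
  let p : Rᵐᵒᵖ →ₗ[Rᵐᵒᵖ] rightPrincipal e := LinearMap.toSpanSingleton _ _ (rightGen e)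
  exact Module.Projective.of_split s p
    (LinearMap.ext fun y => Subtype.ext (idem_mul_of_mem_rightPrincipal he y.2))

lemma OuterTensor.projective_right {k : Type w} [Field k] {W : Type u} {N : Type v}
    [AddCommGroup W] [Module k W] [Module.Finite k W] [AddCommGroup N] [Module k N] {A : Type m}
    [Ring A] [Algebra k A] [Module Aᵐᵒᵖ N] [IsScalarTower k Aᵐᵒᵖ N]
    [Module.Projective Aᵐᵒᵖ N] : Module.Projective Aᵐᵒᵖ (OuterTensor k W N) := by
  classical
  let B := Module.finBasis k W
  let f : (Fin (Module.finrank k W) → N) →ₗ[Aᵐᵒᵖ] OuterTensor k W N :=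
    { toFun := fun n => ∑ b, tmul k (B b) (n b)
      map_add' := fun n n' => by
        simp only [Pi.add_apply, tmul_add, Finset.sum_add_distrib]
      map_smul' := fun a n => by
        simp only [Pi.smul_apply, ← op_smul_tmul, Finset.smul_sum, RingHom.id_apply] }
  have hf : Function.Bijective f := by
    refine ⟨(injective_iff_map_eq_zero f).mpr fun n hn => funext fun b => ?_, fun t => ?_⟩
    · exact eq_zero_of_sum_basis B n hn b
    · obtain ⟨n, rfl⟩ := exists_eq_sum_basis B t
      exact ⟨n, rfl⟩
  have : Module.Projective Aᵐᵒᵖ (Fin (Module.finrank k W) → N) :=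
    Module.Projective.of_equiv DFinsupp.linearEquivFunOnFintype
  exact Module.Projective.of_equiv (LinearEquiv.ofBijective f hf)

/-- The minimal projective resolution of a projective module. -/
def MinimalProjectiveResolution.ofProjective (R : Type u) [Ring R] (X : Type m) [AddCommGroup X]
    [Module R X] [Module.Projective R X] : MinimalProjectiveResolution R X where
  P n := Nat.casesOn n X fun _ => PUnit
  addCommGroup n := by
    cases n with
    | zero => exact ‹AddCommGroup X›
    | succ n => exact PUnit.addCommGroup
  module n := by
    cases n with
    | zero => exact ‹Module R X›
    | succ n => exact PUnit.module
  projective n := by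
    cases n with
    | zero => assumption
    | succ n => exact (inferInstance : Module.Projective R PUnit.{m + 1})
  aug := (LinearMap.id : X →ₗ[R] X)
  d n := by
    cases n with
    | zero => exact (0 : PUnit.{m + 1} →ₗ[R] X)
    | succ n => exact (0 : PUnit.{m + 1} →ₗ[R] PUnit.{m + 1})
  aug_surjective := Function.surjective_id
  exact_zero := fun x => ⟨fun h => ⟨PUnit.unit, Eq.symm h⟩, fun ⟨_, h⟩ => Eq.symm h⟩
  exact_succ n := fun x => ⟨fun _ => ⟨PUnit.unit, rfl⟩, fun _ => by cases n <;> rfl⟩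
  ker_aug L hL := by
    have h : LinearMap.ker (LinearMap.id : X →ₗ[R] X) ⊔ L = ⊤ := hL
    rwa [LinearMap.ker_id, bot_sup_eq] at h
  -- The source of `d n` is the term of index `n + 1`, which is trivial, so each of its submodules
  -- is everything.
  ker_d n L _ := (Submodule.eq_top_iff').mpr fun _ => L.zero_mem

namespace PathAlgebra

variable {k : Type w} [Field k] {Q : Type u} [Quiver.{v} Q] [Fintype Q]
  {I : TwoSidedIdeal (PathAlgebra k Q)}

lemma vertexChar_op_smul (hI : IsAdmissible I) {a b : Q}
    (x : rightPrincipal (vertexIdem I a)) (y : QuotAlgebra I) :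
    vertexChar hI b ((MulOpposite.op y • x : rightPrincipal (vertexIdem I a)) : QuotAlgebra I) =
      vertexChar hI b (x : QuotAlgebra I) * vertexChar hI b y :=
  map_mul (vertexChar hI b) _ _

/-- A homomorphism from `W ⊗ e_j Γ` to `e_a Γ` is not surjective if `a ≠ j`: its values have no
component at the trivial path. -/
lemma vertexChar_eq_zero_of_ne (hI : IsAdmissible I) {W : Type*} [AddCommGroup W] [Module k W]
    {a j : Q} (haj : a ≠ j)
    (r : OuterTensor k W (rightPrincipal (vertexIdem I j)) →ₗ[(QuotAlgebra I)ᵐᵒᵖ]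
      rightPrincipal (vertexIdem I a))
    (t : OuterTensor k W (rightPrincipal (vertexIdem I j))) :
    vertexChar hI a (r t : QuotAlgebra I) = 0 := by
  induction t using OuterTensor.induction_on with
  | zero => rw [map_zero]; exact map_zero _
  | add s t hs ht => rw [map_add, Submodule.coe_add, map_add, hs, ht, add_zero]
  | tmul x y =>
    -- As `y = e_j y`, the value at `x ⊗ y` is a right multiple by `y`, and the character at `a ≠ j`
    -- vanishes on `e_j`, hence on `y`.
    have hy : y = MulOpposite.op (y : QuotAlgebra I) • rightGen (vertexIdem I j) :=
      Subtype.ext (idem_mul_of_mem_rightPrincipal (vertexIdem_mul_self I j) y.2).symm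
    have hy' : vertexChar hI a (y : QuotAlgebra I) = 0 := by
      rw [← idem_mul_of_mem_rightPrincipal (vertexIdem_mul_self I j) y.2, map_mul,
        vertexChar_vertexIdem_of_ne hI (Ne.symm haj), zero_mul]
    rw [hy, ← OuterTensor.op_smul_tmul, map_smul, vertexChar_op_smul, hy', mul_zero]

/-- A split map onto `e_a Γ` would hit `e_a`, where the character at `a` is `1`; for `a ≠ j` this is
impossible from copies of `e_j Γ`. The vertex `j` itself is outside the left support, since `e_j`
kills `W`. -/
lemma hasStronglyFiniteRightPD (hI : IsAdmissible I) {W : Type (max u v w)} [AddCommGroup W]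
    [Module k W] [Module.Finite k W] [Module (QuotAlgebra I) W]
    [IsScalarTower k (QuotAlgebra I) W] {j : Q} (hW : ∀ x : W, vertexIdem I j • x = 0) :
    HasStronglyFiniteRightPD (vertexIdem I)
      (OuterTensor k W (rightPrincipal (vertexIdem I j))) := by
  have := projective_rightPrincipal (vertexIdem_mul_self I j)
  have : Module.Projective (QuotAlgebra I)ᵐᵒᵖ
      (OuterTensor k W (rightPrincipal (vertexIdem I j))) := OuterTensor.projective_right
  refine ⟨(projectiveDimension_lt_top_iff _).mpr
    ⟨0, hasProjectiveDimensionLE_zero_iff_projective.mpr this⟩,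
    MinimalProjectiveResolution.ofProjective _ _, ?_⟩
  refine Set.eq_empty_iff_forall_notMem.mpr ?_
  rintro a ⟨⟨t, ht⟩, n, s, r, hsr⟩
  by_cases haj : a = j
  · subst haj
    exact ht (OuterTensor.smul_eq_zero_of_forall hW t)
  · have h1 : r (s (rightGen (vertexIdem I a))) = rightGen (vertexIdem I a) :=
      LinearMap.congr_fun hsr _
    cases n with
    | zero =>
      have h2 := vertexChar_eq_zero_of_ne hI (W := W) haj r (s (rightGen (vertexIdem I a)))
      have h3 := (congrArg (fun x : rightPrincipal (vertexIdem I a) =>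
        vertexChar hI a (x : QuotAlgebra I)) h1).symm.trans h2
      exact one_ne_zero ((vertexChar_vertexIdem hI a).symm.trans h3)
    | succ n =>
      have h2 : s (rightGen (vertexIdem I a)) = 0 := Subsingleton.elim (α := PUnit.{max u v w + 1}) _ _
      rw [h2, map_zero] at h1
      exact vertexIdem_ne_zero hI a (congrArg Subtype.val h1).symm

end PathAlgebra

/-! ## Finiteness of the bimodule -/

section Finite

variable {k : Type w} [Field k] {R : Type u} [Ring R] [Algebra k R] [Module.Finite k R]

lemma finite_leftPrincipal_quotient (e : R) (V : Submodule R (leftPrincipal e)) :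
    Module.Finite k (leftPrincipal e ⧸ V) := by
  have : Module.Finite k (leftPrincipal e) :=
    inferInstanceAs (Module.Finite k ((leftPrincipal e).restrictScalars k))
  exact Module.Finite.of_surjective (V.mkQ.restrictScalars k) V.mkQ_surjective

lemma finite_rightPrincipal (e : R) : Module.Finite k (rightPrincipal e) :=
  inferInstanceAs (Module.Finite k ((rightPrincipal e).restrictScalars k))

lemma OuterTensor.finite (W : Type u) (N : Type v) [AddCommGroup W] [Module k W]
    [AddCommGroup N] [Module k N] [Module.Finite k W] [Module.Finite k N] :
    Module.Finite k (OuterTensor k W N) :=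
  inferInstanceAs (Module.Finite k (W ⊗[k] N))

lemma OuterTensor.nontrivial (W : Type u) (N : Type v) [AddCommGroup W] [Module k W]
    [AddCommGroup N] [Module k N] [Module.Finite k W] [Module.Finite k N] [Nontrivial W]
    [Nontrivial N] : Nontrivial (OuterTensor k W N) := by
  have h : 0 < Module.finrank k (W ⊗[k] N) := by
    rw [Module.finrank_tensorProduct]
    exact Nat.mul_pos Module.finrank_pos Module.finrank_pos
  have : Nontrivial (W ⊗[k] N) := Module.nontrivial_of_finrank_pos h
  exact this

end Finite

theorem theoremF {k : Type w} [Field k] {Q : Type u} [Quiver.{v} Q] [Fintype Q]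
    [∀ a b : Q, Finite (a ⟶ b)]
    (I : TwoSidedIdeal (PathAlgebra k Q)) (hI : PathAlgebra.IsAdmissible I)
    (i j : Q) (hij : i ≠ j)
    (V : Submodule (PathAlgebra.QuotAlgebra I) (leftPrincipal (PathAlgebra.vertexIdem I i)))
    (hV : ∀ x : leftPrincipal (PathAlgebra.vertexIdem I i),
      (∃ y, (x : PathAlgebra.QuotAlgebra I) =
        PathAlgebra.vertexIdem I j * y * PathAlgebra.vertexIdem I i) → x ∈ V)
    (hV' : V ≤ Module.jacobson (PathAlgebra.QuotAlgebra I)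
      (leftPrincipal (PathAlgebra.vertexIdem I i))) :
    (Nontrivial (oneArrowBimodule I i j V) ∧
      Module.Finite k (oneArrowBimodule I i j V) ∧
      HasStronglyFiniteRightPD (PathAlgebra.vertexIdem I) (oneArrowBimodule I i j V) ∧
      Nonempty (PathAlgebra.QuotAlgebra (oneArrowIdeal I i j V) ≃ₐ[k]
        TrivSqZeroExt (PathAlgebra.QuotAlgebra I) (oneArrowBimodule I i j V))) ∧
    (littleFinitisticDim (PathAlgebra.QuotAlgebra (oneArrowIdeal I i j V)) < ⊤ ↔
      littleFinitisticDim (PathAlgebra.QuotAlgebra I) < ⊤) ∧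
    (bigFinitisticDim (PathAlgebra.QuotAlgebra (oneArrowIdeal I i j V)) < ⊤ ↔
      bigFinitisticDim (PathAlgebra.QuotAlgebra I) < ⊤) ∧
    (globalDim (PathAlgebra.QuotAlgebra (oneArrowIdeal I i j V)) < ⊤ ↔
      globalDim (PathAlgebra.QuotAlgebra I) < ⊤) := by
  have hΓ : Module.Finite k (PathAlgebra.QuotAlgebra I) := PathAlgebra.finite_quotAlgebra hI
  have hW : Module.Finite k (leftPrincipal (PathAlgebra.vertexIdem I i) ⧸ V) :=
    finite_leftPrincipal_quotient _ V
  have hN : Module.Finite k (rightPrincipal (PathAlgebra.vertexIdem I j)) :=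
    finite_rightPrincipal _
  have hM : Module.Finite k (oneArrowBimodule I i j V) := OuterTensor.finite _ _
  have he := PathAlgebra.vertexIdem_mul_self I
  have heW : ∀ x : leftPrincipal (PathAlgebra.vertexIdem I i) ⧸ V,
      PathAlgebra.vertexIdem I j • x = 0 := fun x => by
    obtain ⟨x, rfl⟩ := V.mkQ_surjective x
    rw [← map_smul]
    exact (Submodule.Quotient.mk_eq_zero V).mpr
      (AddArrow.coe_smul_mem hV (rightGen (PathAlgebra.vertexIdem I j)) x)
  have hgen := fun a => PathAlgebra.vertexIdem_ne_zero hI a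
  have : Nontrivial (leftPrincipal (PathAlgebra.vertexIdem I i)) :=
    ⟨leftGen _, 0, fun h => hgen i (congrArg Subtype.val h)⟩
  have : Nontrivial (rightPrincipal (PathAlgebra.vertexIdem I j)) :=
    ⟨rightGen _, 0, fun h => hgen j (congrArg Subtype.val h)⟩
  -- A nonzero finitely generated module is not equal to its radical, so `V` inside the radical is
  -- proper; this makes the bimodule nonzero.
  have : Nontrivial (leftPrincipal (PathAlgebra.vertexIdem I i) ⧸ V) :=
    Submodule.Quotient.nontrivial_iff.mpr (hV'.trans_lt (Module.jacobson_lt_top _ _)).ne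
  let θ := AddArrow.equivTrivExt hV
  have hlifts := (OuterTensor.hasLifts_splitExtension (he j) heW
    (Module.finBasis k _)).congr θ.toRingEquiv
  have hfin : Module.Finite k (PathAlgebra.QuotAlgebra (oneArrowIdeal I i j V)) :=
    have : Module.Finite k (TrivSqZeroExt (PathAlgebra.QuotAlgebra I)
      (oneArrowBimodule I i j V)) :=
      inferInstanceAs (Module.Finite k (PathAlgebra.QuotAlgebra I × oneArrowBimodule I i j V))
    Module.Finite.equiv θ.symm.toLinearEquiv
  -- Finite dimension over `k` yields the Noetherian hypothesis needed for the little finitistic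
  -- dimension.
  have : IsNoetherianRing (PathAlgebra.QuotAlgebra (oneArrowIdeal I i j V)) :=
    isNoetherian_of_tower k inferInstance
  exact ⟨⟨OuterTensor.nontrivial _ _, hM, PathAlgebra.hasStronglyFiniteRightPD hI heW, ⟨θ⟩⟩,
    SplitExtension.littleFinitisticDim_lt_top_iff hlifts,
    SplitExtension.bigFinitisticDim_lt_top_iff hlifts, SplitExtension.globalDim_lt_top_iff hlifts⟩
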